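/- Let $R$ be a Ding–Chen ring, i.e. an associative unital ring that is left and right coherent and satisfies $\mathrm{FP\text{-}id}({}_RR)=\mathrm{FP\text{-}id}(R_R)=n$ for some integer $n\ge 0$. Here the FP-injective dimension $\mathrm{FP\text{-}id}(N)$ of a module $N$ is the least integer $m\ge 0$ such that $\operatorname{Ext}^{m+1}(F,N)=0$ for all finitely presented modules $F$ (and $\infty$ if there is none). Modules are right $R$-modules. A module $M$ is Ding projective if there is an exact sequence of projective modules $\cdots\to P_1\to P_0\to P^0\to P^1\to\cdots$ with $M\cong\ker(P^0\to P^1)$ which remains exact after applying $\operatorname{Hom}_R(-,F)$ for every flat module $F$. A module $W$ is trivial if it has finite flat dimension or, equivalently over such a ring (by a theorem of Ding and Chen), finite FP-injective dimension. Then a module $M$ is Ding projective if and only if $\operatorname{Ext}^1_R(M,W)=0$ for all trivial modules $W$. Consequently, the class of Ding projective modules is exactly the left orthogonal class (with respect to $\operatorname{Ext}^1_R$) of the class of modules of finite flat dimension, and likewise of the class of modules of finite FP-injective dimension. -/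

import Mathlib

universe u

open CategoryTheory
open scoped TensorProduct MulOpposite

namespace DingChen

/-! Left `R`-modules are the objects of `ModuleCat R`; right `R`-modules are left modules over the
opposite ring, i.e. objects of `ModuleCat Rᵐᵒᵖ`, with `m r` written `MulOpposite.op r • m`. -/

/-- The category of right modules over `R`. -/
abbrev RightMod (R : Type u) [Ring R] := ModuleCat.{u} Rᵐᵒᵖ

section Tensor

variable (R : Type u) [Ring R] (M : Type u) [AddCommGroup M] [Module Rᵐᵒᵖ M]

/-- The relations `(m r) ⊗ a = m ⊗ (r a)` inside `M ⊗_ℤ A`. -/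
def tensorRel (A : Type u) [AddCommGroup A] [Module R A] : Submodule ℤ (M ⊗[ℤ] A) :=
  Submodule.span ℤ
    {t | ∃ (r : R) (m : M) (a : A), t = (MulOpposite.op r • m) ⊗ₜ[ℤ] a - m ⊗ₜ[ℤ] (r • a)}

/-- The abelian group `M ⊗_R A`, for a right module `M` and a left module `A` over a ring `R` that
need not be commutative. -/
abbrev BalancedTensor (A : Type u) [AddCommGroup A] [Module R A] : Type u :=
  (M ⊗[ℤ] A) ⧸ tensorRel R M A

variable {R}

theorem tensorRel_le_comap {A B : Type u} [AddCommGroup A] [Module R A] [AddCommGroup B]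
    [Module R B] (f : A →ₗ[R] B) :
    tensorRel R M A ≤
      (tensorRel R M B).comap (LinearMap.lTensor M f.toAddMonoidHom.toIntLinearMap) := by
  refine Submodule.span_le.2 ?_
  rintro _ ⟨r, m, a, rfl⟩
  refine Submodule.subset_span ⟨r, m, f a, ?_⟩
  simp

/-- The map `M ⊗_R f : M ⊗_R A → M ⊗_R B`. -/
def balancedTensorMap {A B : Type u} [AddCommGroup A] [Module R A] [AddCommGroup B]
    [Module R B] (f : A →ₗ[R] B) : BalancedTensor R M A →ₗ[ℤ] BalancedTensor R M B :=
  Submodule.mapQ (tensorRel R M A) (tensorRel R M B)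
    (LinearMap.lTensor M f.toAddMonoidHom.toIntLinearMap) (tensorRel_le_comap M f)

end Tensor

/-- A right `R`-module `M` is flat if `M ⊗_R -` preserves injectivity of maps of left modules. -/
def IsFlat {R : Type u} [Ring R] (M : RightMod R) : Prop :=
  ∀ (A B : Type u) [AddCommGroup A] [Module R A] [AddCommGroup B] [Module R B] (f : A →ₗ[R] B),
    Function.Injective f → Function.Injective (balancedTensorMap (M : Type u) f)

/-- `HasFlatResolution n M`: there is an exact sequence `0 → F_n → ⋯ → F_1 → F_0 → M → 0` of right
modules with every `F_i` flat. For `n = 0` this says that `M` is flat, and such a sequence of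
length `n + 1` is the same as a short exact sequence `0 → K → F_0 → M → 0` with `F_0` flat together
with such a sequence of length `n` for `K`. -/
def HasFlatResolution {R : Type u} [Ring R] : ℕ → RightMod R → Prop
  | 0, M => IsFlat M
  | n + 1, M => ∃ (K F : RightMod R) (i : K ⟶ F) (p : F ⟶ M),
      Function.Injective i ∧ Function.Exact i p ∧ Function.Surjective p ∧
        IsFlat F ∧ HasFlatResolution n K

/-- The flat dimension of a right module: the least length of a flat resolution (`⊤` if there is
no finite one). -/
noncomputable def flatDim {R : Type u} [Ring R] (M : RightMod R) : ℕ∞ :=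
  sInf {d : ℕ∞ | ∃ n : ℕ, d = n ∧ HasFlatResolution n M}

/-- The FP-injective dimension of an `S`-module `N`: the least `n ≥ 0` such that
`Ext^{n+1}_S(F, N) = 0` for all finitely presented `F` (`⊤` if there is no such `n`). -/
noncomputable def fpInjDim {S : Type u} [Ring S] (N : ModuleCat.{u} S) : ℕ∞ :=
  sInf {d : ℕ∞ | ∃ n : ℕ, d = n ∧
    ∀ F : ModuleCat.{u} S, Module.FinitePresentation S F → Subsingleton (Abelian.Ext F N (n + 1))}

/-- `R` is left coherent: every finitely generated left ideal is finitely presented. -/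
def IsLeftCoherent (R : Type u) [Ring R] : Prop :=
  ∀ I : Submodule R R, I.FG → Module.FinitePresentation R I

/-- `R` is right coherent: every finitely generated right ideal is finitely presented. -/
def IsRightCoherent (R : Type u) [Ring R] : Prop :=
  ∀ I : Submodule Rᵐᵒᵖ R, I.FG → Module.FinitePresentation Rᵐᵒᵖ I

/-- An `n`-FC ring. -/
structure IsNFCRing (R : Type u) [Ring R] (n : ℕ) : Prop where
  leftCoherent : IsLeftCoherent R
  rightCoherent : IsRightCoherent R
  fpInjDim_left : fpInjDim (ModuleCat.of R R) = n
  fpInjDim_right : fpInjDim (ModuleCat.of Rᵐᵒᵖ R) = n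

/-- A Ding-Chen ring is an `n`-FC ring for some `n ≥ 0`. -/
def IsDingChenRing (R : Type u) [Ring R] : Prop := ∃ n : ℕ, IsNFCRing R n

/-- A right module is trivial if it has finite flat dimension or finite FP-injective dimension.
(Over a Ding-Chen ring, the only case in which this is used, the two conditions are equivalent.) -/
def IsTrivial {R : Type u} [Ring R] (W : RightMod R) : Prop :=
  flatDim W < ⊤ ∨ fpInjDim W < ⊤

/-- A right module `M` is Ding projective if `M ≅ ker (P⁰ → P¹)` for an exact complex
`⋯ → P⁻¹ → P⁰ → P¹ → ⋯` of projectives which stays exact under `Hom(-, F)` for all flat `F`. -/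
def IsDingProjective {R : Type u} [Ring R] (M : RightMod R) : Prop :=
  ∃ P : CochainComplex (RightMod R) ℤ,
    (∀ i, Module.Projective Rᵐᵒᵖ (P.X i)) ∧
    P.Acyclic ∧
    (∀ F : RightMod R, IsFlat F → ∀ i j k : ℤ, i + 1 = j → j + 1 = k →
      Function.Exact (fun h : P.X k ⟶ F => P.d j k ≫ h) (fun g : P.X j ⟶ F => P.d i j ≫ g)) ∧
    Nonempty (M ≅ Limits.kernel (P.d 0 1))

/-- The left orthogonal class: all `M` with `Ext¹(M, W) = 0` for every `W` in the class. -/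
def leftPerp {R : Type u} [Ring R] (𝒲 : Set (RightMod R)) : Set (RightMod R) :=
  {M | ∀ W ∈ 𝒲, Subsingleton (Abelian.Ext M W 1)}

end DingChen

/-! Over an n-FC ring, each of the three classes in the theorem is the class of right modules N with
`FPInjDimLE n N`, so everything reduces to Ding projective = `perp R n`.

The two notions of dimension are compared through matrices. A matrix acting on row vectors over N is
at once a tensor product map N ⊗ R^ι → N ⊗ R^κ and Hom(-, N) of a map of free right modules. A flat
N preserves exactness of row complexes over R, so it inherits Ext vanishing from R
(`HasFlatResolution.fpInjDimLE`). Conversely, a free resolution of a finitely presented left module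
has a dual that is exact from some degree on, because R has finite FP-injective dimension on the
left. Shifting along this dual turns Ext vanishing for N into Tor vanishing
(`FPInjDimLE.torVanishes`), which gives a flat resolution of length n.

If M is Ding projective, the cycles of its complex have no Ext¹ into flat modules, and induction on
the length of a flat resolution extends this to every trivial module. If M is in `perp R n`, it has
a syzygy in the class, and the small object argument embeds it in a trivial module with cokernel in
the class. That trivial module then lies in `perp R n` too, which forces it to be projective.
Splicing these steps in both directions gives the complex. -/

namespace DingChen

/-! ### Vanishing of Ext along short exact sequences -/

section Ext

universe w v v'

open Abelian

variable {C : Type v'} [Category.{v} C] [Abelian C] [HasExt.{w} C] {S : ShortComplex C}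

theorem subsingleton_ext_X₃_of_contravariant (hS : S.ShortExact) (Y : C) (n : ℕ)
    (h₁ : Subsingleton (Ext S.X₁ Y n)) (h₂ : Subsingleton (Ext S.X₂ Y (n + 1))) :
    Subsingleton (Ext S.X₃ Y (n + 1)) := by
  refine subsingleton_of_forall_eq 0 fun x => ?_
  obtain ⟨y, rfl⟩ := Ext.contravariant_sequence_exact₃ hS Y x (Subsingleton.elim _ _)
    (add_comm 1 n)
  rw [Subsingleton.elim y 0, Ext.comp_zero]

theorem subsingleton_ext_X₁_of_contravariant (hS : S.ShortExact) (Y : C) (n : ℕ)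
    (h₂ : Subsingleton (Ext S.X₂ Y n)) (h₃ : Subsingleton (Ext S.X₃ Y (n + 1))) :
    Subsingleton (Ext S.X₁ Y n) := by
  refine subsingleton_of_forall_eq 0 fun x => ?_
  obtain ⟨y, rfl⟩ := Ext.contravariant_sequence_exact₁ hS Y x (add_comm 1 n)
    (Subsingleton.elim _ _)
  rw [Subsingleton.elim y 0, Ext.comp_zero]

theorem subsingleton_ext_X₂_of_contravariant (hS : S.ShortExact) (Y : C) (n : ℕ)
    (h₁ : Subsingleton (Ext S.X₁ Y n)) (h₃ : Subsingleton (Ext S.X₃ Y n)) :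
    Subsingleton (Ext S.X₂ Y n) := by
  refine subsingleton_of_forall_eq 0 fun x => ?_
  obtain ⟨y, rfl⟩ := Ext.contravariant_sequence_exact₂ hS Y x (Subsingleton.elim _ _)
  rw [Subsingleton.elim y 0, Ext.comp_zero]

theorem subsingleton_ext_X₃_of_covariant (hS : S.ShortExact) (X : C) (n : ℕ)
    (h₂ : Subsingleton (Ext X S.X₂ n)) (h₁ : Subsingleton (Ext X S.X₁ (n + 1))) :
    Subsingleton (Ext X S.X₃ n) := by
  refine subsingleton_of_forall_eq 0 fun x => ?_
  obtain ⟨y, rfl⟩ := Ext.covariant_sequence_exact₃ X hS x rfl (Subsingleton.elim _ _)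
  rw [Subsingleton.elim y 0, Ext.zero_comp]

theorem subsingleton_ext_X₁_of_covariant (hS : S.ShortExact) (X : C) (n : ℕ)
    (h₃ : Subsingleton (Ext X S.X₃ n)) (h₂ : Subsingleton (Ext X S.X₂ (n + 1))) :
    Subsingleton (Ext X S.X₁ (n + 1)) := by
  refine subsingleton_of_forall_eq 0 fun x => ?_
  obtain ⟨y, rfl⟩ := Ext.covariant_sequence_exact₁ X hS x (Subsingleton.elim _ _) rfl
  rw [Subsingleton.elim y 0, Ext.zero_comp]

/-- If `Ext¹(X₃, Y) = 0`, then every `X₁ ⟶ Y` extends to `X₂`. -/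
theorem exists_extension_of_ext (hS : S.ShortExact) (Y : C)
    (h₃ : Subsingleton (Ext S.X₃ Y 1)) (φ : S.X₁ ⟶ Y) : ∃ ψ : S.X₂ ⟶ Y, S.f ≫ ψ = φ := by
  obtain ⟨y, hy⟩ := Ext.contravariant_sequence_exact₁ hS Y (Ext.mk₀ φ) (add_zero 1)
    (Subsingleton.elim _ _)
  obtain ⟨ψ, rfl⟩ := Ext.mk₀_bijective _ _ |>.2 y
  exact ⟨ψ, (Ext.mk₀_bijective _ _).1 (by simpa using hy)⟩

theorem subsingleton_ext_of_extension (hS : S.ShortExact) (Y : C)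
    (h₂ : Subsingleton (Ext S.X₂ Y 1)) (h : ∀ φ : S.X₁ ⟶ Y, ∃ ψ : S.X₂ ⟶ Y, S.f ≫ ψ = φ) :
    Subsingleton (Ext S.X₃ Y 1) := by
  refine subsingleton_of_forall_eq 0 fun x => ?_
  obtain ⟨y, rfl⟩ := Ext.contravariant_sequence_exact₃ hS Y x (Subsingleton.elim _ _)
    (add_zero 1)
  obtain ⟨φ, rfl⟩ := Ext.mk₀_bijective _ _ |>.2 y
  obtain ⟨ψ, rfl⟩ := h φ
  rw [← Ext.mk₀_comp_mk₀, hS.extClass_comp_assoc]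

theorem subsingleton_ext_of_lifting (hS : S.ShortExact) (X : C)
    (h₂ : Subsingleton (Ext X S.X₂ 1)) (h : ∀ φ : X ⟶ S.X₃, ∃ ψ : X ⟶ S.X₂, ψ ≫ S.g = φ) :
    Subsingleton (Ext X S.X₁ 1) := by
  refine subsingleton_of_forall_eq 0 fun x => ?_
  obtain ⟨y, rfl⟩ := Ext.covariant_sequence_exact₁ X hS x (Subsingleton.elim _ _) (zero_add 1)
  obtain ⟨φ, rfl⟩ := Ext.mk₀_bijective _ _ |>.2 y
  obtain ⟨ψ, rfl⟩ := h φ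
  rw [← Ext.mk₀_comp_mk₀, Ext.comp_assoc _ _ _ (zero_add 0) (zero_add 1) (by simp),
    hS.comp_extClass, Ext.comp_zero]

end Ext

section ShortExact

variable {S : Type u} [Ring S]

/-- A short exact sequence of modules, from linear maps. -/
theorem shortExact_of_linearMap {X Y Z : Type u} [AddCommGroup X] [AddCommGroup Y] [AddCommGroup Z]
    [Module S X] [Module S Y] [Module S Z] (f : X →ₗ[S] Y) (g : Y →ₗ[S] Z)
    (hf : Function.Injective f) (hfg : Function.Exact f g) (hg : Function.Surjective g) :
    (ShortComplex.mk (ModuleCat.ofHom f) (ModuleCat.ofHom g)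
      (by ext x; exact (hfg (f x)).2 ⟨x, rfl⟩)).ShortExact where
  exact := (ShortComplex.ShortExact.moduleCat_exact_iff_function_exact _).2 hfg
  mono_f := (ModuleCat.mono_iff_injective _).2 hf
  epi_g := (ModuleCat.epi_iff_surjective _).2 hg

theorem shortExact_submodule {Y Z : Type u} [AddCommGroup Y] [AddCommGroup Z]
    [Module S Y] [Module S Z] (N : Submodule S Y) (g : Y →ₗ[S] Z)
    (hN : LinearMap.ker g = N) (hg : Function.Surjective g) :
    (ShortComplex.mk (ModuleCat.ofHom N.subtype) (ModuleCat.ofHom g)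
      (by subst hN; ext x; exact x.2)).ShortExact :=
  shortExact_of_linearMap _ _ N.subtype_injective
    (by subst hN; exact g.exact_subtype_ker_map) hg

end ShortExact

/-! ### Matrices as maps of free modules, and their duals -/

section Matrices

variable {R : Type u} [Ring R]

/-- Multiplication of row vectors with entries in a right module by a matrix over `R`. -/
def rowAct (N : Type u) [AddCommGroup N] [Module Rᵐᵒᵖ N] {ι κ : Type*} [Fintype ι]
    (A : Matrix ι κ R) : (ι → N) →+ (κ → N) where
  toFun v j := ∑ i, MulOpposite.op (A i j) • v i
  map_zero' := by ext; simp
  map_add' v w := by ext; simp [Finset.sum_add_distrib]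

theorem rowAct_apply (N : Type u) [AddCommGroup N] [Module Rᵐᵒᵖ N] {ι κ : Type*} [Fintype ι]
    (A : Matrix ι κ R) (v : ι → N) (j : κ) :
    rowAct N A v j = ∑ i, MulOpposite.op (A i j) • v i := rfl

variable {N : Type u} [AddCommGroup N] [Module Rᵐᵒᵖ N] {ι κ ℓ : Type*} [Fintype ι]

theorem rowAct_rowAct [Fintype κ] (A : Matrix ι κ R) (B : Matrix κ ℓ R) (v : ι → N) :
    rowAct N B (rowAct N A v) = rowAct N (A * B) v := by
  ext j
  simp only [rowAct_apply, Matrix.mul_apply, Finset.smul_sum, Finset.op_sum, Finset.sum_smul]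
  rw [Finset.sum_comm]
  simp [mul_smul]

theorem rowAct_map {N' : Type u} [AddCommGroup N'] [Module Rᵐᵒᵖ N'] (f : N →ₗ[Rᵐᵒᵖ] N')
    (A : Matrix ι κ R) (v : ι → N) : rowAct N' A (f ∘ v) = f ∘ rowAct N A v := by
  ext j
  simp [rowAct_apply]

theorem mul_eq_zero_of_exact [Fintype κ] [DecidableEq ι] {A : Matrix ι κ R} {B : Matrix κ ℓ R}
    (h : Function.Exact (rowAct R A) (rowAct R B)) : A * B = 0 := by
  ext i j
  have := congrFun ((h (rowAct R A (Pi.single i 1))).2 ⟨_, rfl⟩) j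
  rw [rowAct_rowAct] at this
  simpa [rowAct_apply, Pi.single_apply] using this

/-- The homomorphism of left modules given by a matrix acting on row vectors. -/
def rowMap (A : Matrix ι κ R) : (ι → R) →ₗ[R] (κ → R) where
  toFun := rowAct R A
  map_add' := map_add _
  map_smul' r v := by ext j; simp [rowAct_apply, Finset.mul_sum, mul_assoc]

@[simp]
theorem rowMap_apply (A : Matrix ι κ R) (v : ι → R) : rowMap A v = rowAct R A v := rfl

/-- The homomorphism of right modules given by a matrix acting on column vectors. -/
def colMap {ι κ : Type*} [Fintype κ] (A : Matrix ι κ R) : (κ → R) →ₗ[Rᵐᵒᵖ] (ι → R) where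
  toFun := A.mulVec
  map_add' := A.mulVec_add
  map_smul' r v := by ext j; simp [Matrix.mulVec, dotProduct, Finset.sum_mul, mul_assoc]

@[simp]
theorem colMap_apply {ι κ : Type*} [Fintype κ] (A : Matrix ι κ R) (v : κ → R) :
    colMap A v = A.mulVec v := rfl

/-- The homomorphism of right modules `R^ι → N` given by a row vector. -/
def colEval (v : ι → N) : (ι → R) →ₗ[Rᵐᵒᵖ] N where
  toFun y := ∑ i, MulOpposite.op (y i) • v i
  map_add' y z := by simp [add_smul, Finset.sum_add_distrib]
  map_smul' r y := by simp [Finset.smul_sum, mul_smul]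

theorem colEval_apply (v : ι → N) (y : ι → R) :
    colEval v y = ∑ i, MulOpposite.op (y i) • v i := rfl

/-- Identifies Hom(-, N) of a column map with the row action on N. This lets one matrix complex
compute both Ext into N and the tensor product with N. -/
theorem colEval_comp_colMap [Fintype κ] (v : ι → N) (A : Matrix ι κ R) :
    colEval v ∘ₗ colMap A = colEval (rowAct N A v) := by
  refine LinearMap.ext fun y => ?_
  simp only [LinearMap.comp_apply, colEval_apply, colMap_apply, Matrix.mulVec, dotProduct,
    rowAct_apply, Finset.op_sum, Finset.sum_smul, Finset.smul_sum]
  rw [Finset.sum_comm]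
  simp [mul_smul]

theorem colEval_bijective :
    Function.Bijective (colEval : (ι → N) → ((ι → R) →ₗ[Rᵐᵒᵖ] N)) := by
  classical
  constructor
  · intro v w h
    ext i
    simpa [colEval_apply, Pi.single_apply, apply_ite MulOpposite.op, ite_smul] using
      LinearMap.congr_fun h (Pi.single i 1)
  · intro f
    refine ⟨fun i => f (Pi.single i 1), ?_⟩
    refine LinearMap.ext fun y => ?_
    rw [colEval_apply]
    simp only [← map_smul, ← map_sum]
    congr 1
    ext j
    simp [Finset.sum_apply, Pi.single_apply]

/-- The homomorphism of left modules `R^ι → R` given by a column vector. -/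
def rowEval (y : ι → R) : (ι → R) →ₗ[R] R where
  toFun x := ∑ i, x i * y i
  map_add' y z := by simp [add_mul, Finset.sum_add_distrib]
  map_smul' r y := by simp [Finset.mul_sum, mul_assoc]

theorem rowEval_apply (y x : ι → R) : rowEval y x = ∑ i, x i * y i := rfl

theorem rowEval_comp_rowMap [Fintype κ] (y : κ → R) (A : Matrix ι κ R) :
    rowEval y ∘ₗ rowMap A = rowEval (colMap A y) := by
  refine LinearMap.ext fun x => ?_
  simp only [LinearMap.comp_apply, rowEval_apply, rowMap_apply, rowAct_apply, colMap_apply,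
    Matrix.mulVec, dotProduct, op_smul_eq_mul, Finset.sum_mul, Finset.mul_sum]
  rw [Finset.sum_comm]
  simp [mul_assoc]

theorem rowEval_bijective :
    Function.Bijective (rowEval : (ι → R) → ((ι → R) →ₗ[R] R)) := by
  classical
  constructor
  · intro v w h
    ext i
    simpa [rowEval_apply, Pi.single_apply] using LinearMap.congr_fun h (Pi.single i 1)
  · intro f
    refine ⟨fun i => f (Pi.single i 1), ?_⟩
    refine LinearMap.ext fun y => ?_
    rw [rowEval_apply]
    simp only [← smul_eq_mul, ← map_smul, ← map_sum]
    congr 1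
    ext j
    simp [Finset.sum_apply, Pi.single_apply]

end Matrices

/-! ### Flatness in terms of linear equations -/

section Flat

variable {R : Type u} [Ring R] {M : Type u} [AddCommGroup M] [Module Rᵐᵒᵖ M]

/-- The homomorphism from `M ⊗_R A` induced by a balanced biadditive map. -/
def balancedLift {A G : Type u} [AddCommGroup A] [Module R A] [AddCommGroup G]
    (φ : M →+ A →+ G) (hφ : ∀ (r : R) m a, φ (MulOpposite.op r • m) a = φ m (r • a)) :
    BalancedTensor R M A →ₗ[ℤ] G :=
  (tensorRel R M A).liftQ
    (TensorProduct.liftAddHom φ (fun r m a => by simp)).toIntLinearMap (by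
      refine Submodule.span_le.2 ?_
      rintro _ ⟨r, m, a, rfl⟩
      simp [hφ])

theorem balancedLift_mk_tmul {A G : Type u} [AddCommGroup A] [Module R A] [AddCommGroup G]
    (φ : M →+ A →+ G) (hφ : ∀ (r : R) m a, φ (MulOpposite.op r • m) a = φ m (r • a)) (m : M)
    (a : A) : balancedLift φ hφ (Submodule.Quotient.mk (m ⊗ₜ a)) = φ m a := rfl

theorem mk_smul_tmul {A : Type u} [AddCommGroup A] [Module R A] (r : R) (m : M) (a : A) :
    (Submodule.Quotient.mk ((MulOpposite.op r • m) ⊗ₜ[ℤ] a) : BalancedTensor R M A) =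
      Submodule.Quotient.mk (m ⊗ₜ[ℤ] (r • a)) :=
  (Submodule.Quotient.eq _).2 (Submodule.subset_span ⟨r, m, a, rfl⟩)

variable (R) in
/-- The class in `M ⊗_R A` of the sum of the `v i ⊗ x i`. -/
def tensorSum {A : Type u} [AddCommGroup A] [Module R A] {ι : Type*} [Fintype ι] (v : ι → M)
    (x : ι → A) : BalancedTensor R M A :=
  ∑ i, Submodule.Quotient.mk (v i ⊗ₜ[ℤ] x i)

theorem exists_tensorSum {A : Type u} [AddCommGroup A] [Module R A] (t : BalancedTensor R M A) :
    ∃ (b : ℕ) (v : Fin b → M) (x : Fin b → A), t = tensorSum R v x := by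
  obtain ⟨t, rfl⟩ := Submodule.Quotient.mk_surjective _ t
  obtain ⟨b, v, x, rfl⟩ := TensorProduct.exists_sum_tmul_eq t
  refine ⟨b, v, x, ?_⟩
  simp only [tensorSum, ← Submodule.mkQ_apply, map_sum]

theorem balancedTensorMap_tensorSum {A B : Type u} [AddCommGroup A] [Module R A] [AddCommGroup B]
    [Module R B] (f : A →ₗ[R] B) {ι : Type*} [Fintype ι] (v : ι → M) (x : ι → A) :
    balancedTensorMap M f (tensorSum R v x) = tensorSum R v (f ∘ x) := by
  simp only [tensorSum, map_sum]
  rfl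

/-- `(v C) ⊗ y = v ⊗ (C y)`. -/
theorem tensorSum_rowAct {A : Type u} [AddCommGroup A] [Module R A] {ι κ : Type*} [Fintype ι]
    [Fintype κ] (v : ι → M) (C : Matrix ι κ R) (y : κ → A) :
    tensorSum R (rowAct M C v) y = tensorSum R v (fun i => ∑ j, C i j • y j) := by
  simp only [tensorSum, rowAct_apply, TensorProduct.sum_tmul, TensorProduct.tmul_sum,
    ← Submodule.mkQ_apply, map_sum]
  rw [Finset.sum_comm]
  exact Finset.sum_congr rfl fun i _ => Finset.sum_congr rfl fun j _ => mk_smul_tmul _ _ _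

/-- Exactness over R embeds the cokernel of `A` in R^ℓ. A vector `v` killed by `B` gives the tensor
∑ v_j ⊗ e_j over that cokernel, which dies in M ⊗ R^ℓ and hence is zero by flatness. -/
theorem exact_rowAct_of_isFlat {M : RightMod R} (hM : IsFlat M) {ι κ ℓ : ℕ}
    {A : Matrix (Fin ι) (Fin κ) R} {B : Matrix (Fin κ) (Fin ℓ) R}
    (h : Function.Exact (rowAct R A) (rowAct R B)) :
    Function.Exact (rowAct M A) (rowAct M B) := by
  intro v
  refine ⟨fun hv => ?_, ?_⟩
  swap
  · rintro ⟨w, rfl⟩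
    rw [rowAct_rowAct, mul_eq_zero_of_exact h]
    ext; simp [rowAct_apply]
  let L := LinearMap.range (rowMap A)
  let f : ((Fin κ → R) ⧸ L) →ₗ[R] (Fin ℓ → R) := L.liftQ (rowMap B) (by
    rintro _ ⟨w, rfl⟩
    exact (h _).2 ⟨w, rfl⟩)
  have hf : Function.Injective f := by
    rw [← LinearMap.ker_eq_bot, Submodule.ker_liftQ_eq_bot]
    intro w hw
    exact (h w).1 hw
  let t : BalancedTensor R M ((Fin κ → R) ⧸ L) :=
    tensorSum R v (fun j => L.mkQ (Pi.single j 1))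
  have ht : t = 0 := by
    apply hM _ _ f hf
    rw [balancedTensorMap_tensorSum, map_zero]
    have : (f ∘ fun j => L.mkQ (Pi.single j 1)) =
        fun j => ∑ k, B j k • (Pi.single k 1 : Fin ℓ → R) := by
      ext j k
      simp [f, rowAct_apply, Pi.single_apply]
    rw [this, ← tensorSum_rowAct, hv]
    simp [tensorSum]
  -- A map from M ⊗ coker `A` to this quotient, sending the tensor to the class of `v`, is enough;
  -- no isomorphism is needed.
  let G := (Fin κ → M) ⧸ (rowAct M A).range
  let φ₀ (n : M) : (Fin κ → R) →+ (Fin κ → M) :=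
    { toFun := fun x j => MulOpposite.op (x j) • n
      map_zero' := by ext; simp
      map_add' := fun x y => by ext; simp [add_smul] }
  let φ₁ (n : M) : ((Fin κ → R) ⧸ L) →+ G :=
    QuotientAddGroup.lift L.toAddSubgroup ((QuotientAddGroup.mk' _).comp (φ₀ n)) (by
      rintro _ ⟨w, rfl⟩
      refine (QuotientAddGroup.eq_zero_iff _).2 ⟨fun i => MulOpposite.op (w i) • n, ?_⟩
      ext j
      simp [φ₀, rowAct_apply, Finset.sum_smul, mul_smul])
  let φ : M →+ ((Fin κ → R) ⧸ L) →+ G :=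
    { toFun := φ₁
      map_zero' := by
        ext x
        obtain ⟨x, rfl⟩ := L.mkQ_surjective x
        refine (QuotientAddGroup.eq_zero_iff _).2 ?_
        exact ⟨0, by ext; simp [φ₀]⟩
      map_add' := fun m n => by
        ext x
        obtain ⟨x, rfl⟩ := L.mkQ_surjective x
        refine congrArg (QuotientAddGroup.mk' _) (?_ : φ₀ (m + n) x = φ₀ m x + φ₀ n x)
        ext; simp [φ₀] }
  have h0 := congrArg (balancedLift φ (fun r m x => by
    obtain ⟨x, rfl⟩ := L.mkQ_surjective x
    refine congrArg (QuotientAddGroup.mk' _)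
      (?_ : φ₀ (MulOpposite.op r • m) x = φ₀ m (r • x))
    ext; simp [φ₀, mul_smul])) ht
  rw [map_zero, show t = tensorSum R v _ from rfl, tensorSum, map_sum] at h0
  have h1 : (QuotientAddGroup.mk' (rowAct M A).range v : G) = 0 := by
    rw [← h0]
    simp only [balancedLift_mk_tmul]
    have : v = ∑ j, φ₀ (v j) (Pi.single j 1) := by
      ext j
      simp [φ₀, Finset.sum_apply, Pi.single_apply, apply_ite MulOpposite.op]
    conv_lhs => rw [this, map_sum]
    rfl
  exact (QuotientAddGroup.eq_zero_iff _).1 h1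

/-- M ⊗ B maps to (B →₀ M) modulo the subgroup `D` generated by the multiples m · l of linear
relations l in B. A vanishing tensor therefore puts ∑ v_i [y_i] in `D`. The rows of `C` indexed by
`κ` are the negated relations used, and `z` lists the finitely many elements of B involved. -/
theorem exists_relations_of_tensorSum_eq_zero {B : Type u} [AddCommGroup B] [Module R B] {b : ℕ}
    (v : Fin b → M) (y : Fin b → B) (h : tensorSum R v y = 0) :
    ∃ (κ : Type) (_ : Fintype κ) (m : κ → M) (d : ℕ) (C : Matrix (Fin b ⊕ κ) (Fin d) R)
      (z : Fin d → B), rowAct M C (Sum.elim v m) = 0 ∧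
        ∀ i, ∑ j, C i j • z j = Sum.elim y 0 i := by
  classical
  let D : AddSubgroup (B →₀ M) := AddSubgroup.closure
    {e | ∃ (m : M) (l : B →₀ R), l.sum (fun b r => r • b) = 0 ∧
      e = l.mapRange (fun r => MulOpposite.op r • m) (by simp)}
  have hD (e) (he : e ∈ D) : ∃ (κ : Type) (_ : Fintype κ) (m : κ → M) (l : κ → B →₀ R),
      (∀ k, (l k).sum (fun b r => r • b) = 0) ∧
        e = ∑ k, (l k).mapRange (fun r => MulOpposite.op r • m k) (by simp) := by
    induction he using AddSubgroup.closure_induction with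
    | mem e he =>
      obtain ⟨m, l, hl, rfl⟩ := he
      exact ⟨Unit, inferInstance, fun _ => m, fun _ => l, fun _ => hl, by simp⟩
    | zero => exact ⟨Empty, inferInstance, nofun, nofun, nofun, by simp⟩
    | add e e' _ _ h h' =>
      obtain ⟨κ, _, m, l, hl, rfl⟩ := h
      obtain ⟨κ', _, m', l', hl', rfl⟩ := h'
      refine ⟨κ ⊕ κ', inferInstance, Sum.elim m m', Sum.elim l l', ?_, by simp⟩
      rintro (k | k)
      · exact hl k
      · exact hl' k
    | neg e _ h =>
      obtain ⟨κ, _, m, l, hl, rfl⟩ := h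
      refine ⟨κ, inferInstance, -m, l, hl, ?_⟩
      ext; simp
  let q := QuotientAddGroup.mk' D
  let φ : M →+ B →+ (B →₀ M) ⧸ D := AddMonoidHom.mk' (fun m =>
    AddMonoidHom.mk' (fun b => q (Finsupp.single b m)) (fun b b' => by
      rw [← map_add]
      refine (QuotientAddGroup.eq_iff_sub_mem).2 (AddSubgroup.subset_closure
        ⟨m, Finsupp.single (b + b') 1 - (Finsupp.single b 1 + Finsupp.single b' 1), ?_, ?_⟩)
      · rw [Finsupp.sum_sub_index (by simp [sub_smul]), Finsupp.sum_add_index' (by simp)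
          (by simp [add_smul])]
        simp
      · ext c
        simp only [Finsupp.sub_apply, Finsupp.add_apply, Finsupp.mapRange_apply,
          Finsupp.single_apply]
        split_ifs <;> simp [add_smul]))
    (fun m m' => by ext b; simp)
  have hφ (r : R) (m : M) (b : B) : φ (MulOpposite.op r • m) b = φ m (r • b) := by
    refine (QuotientAddGroup.eq_iff_sub_mem).2 (AddSubgroup.subset_closure
      ⟨m, Finsupp.single b r - Finsupp.single (r • b) 1, ?_, ?_⟩)
    · rw [Finsupp.sum_sub_index (by simp [sub_smul])]
      simp
    · ext c
      simp only [Finsupp.sub_apply, Finsupp.mapRange_apply, Finsupp.single_apply]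
      split_ifs <;> simp [sub_smul]
  have h0 := congrArg (balancedLift φ hφ) h
  rw [map_zero, tensorSum, map_sum] at h0
  simp only [balancedLift_mk_tmul] at h0
  have h1 : ∑ i, Finsupp.single (y i) (v i) ∈ D := by
    rw [← QuotientAddGroup.eq_zero_iff, ← h0]
    exact map_sum q _ _
  obtain ⟨κ, _, m, l, hl, he⟩ := hD _ h1
  let S : Finset B := Finset.univ.image y ∪ Finset.univ.biUnion (fun k => (l k).support)
  let s (j : Fin S.card) : B := (S.equivFin.symm j).1
  have hs (g : B → B) : ∑ j, g (s j) = ∑ c ∈ S, g c := by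
    rw [← Finset.sum_coe_sort S]
    exact S.equivFin.symm.sum_comp (fun c => g c.1)
  refine ⟨κ, inferInstance, m, S.card,
    Matrix.of (Sum.elim (fun i j => if y i = s j then 1 else 0) (fun k j => - l k (s j))), s,
    ?_, ?_⟩
  · ext j
    have := DFunLike.congr_fun he (s j)
    simp only [Finsupp.coe_finsetSum, Finset.sum_apply, Finsupp.single_apply,
      Finsupp.mapRange_apply] at this
    rw [rowAct_apply, Fintype.sum_sum_type]
    simp [apply_ite MulOpposite.op, ite_smul, this]
  · rintro (i | k)
    · simp only [Matrix.of_apply, Sum.elim_inl, ite_smul, one_smul, zero_smul]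
      rw [hs (fun c => if y i = c then c else 0), Finset.sum_ite_eq, if_pos (by simp [S])]
    · simp only [Matrix.of_apply, Sum.elim_inr, neg_smul, Finset.sum_neg_distrib,
        Pi.zero_apply, neg_eq_zero]
      rw [hs (fun c => l k c • c), ← hl k, Finsupp.sum]
      refine (Finset.sum_subset (fun c hc => ?_) (fun c _ hc => ?_)).symm
      · exact Finset.mem_union_right _ (Finset.mem_biUnion.2 ⟨k, Finset.mem_univ _, hc⟩)
      · rw [Finsupp.notMem_support_iff.1 hc, zero_smul]

/-- If `f` kills the tensor v ⊗ x, the relations obtained in B are solved over R by `K`. Then `f`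
sends `K` applied to the padded `x` to K C z = 0, so injectivity kills it, and moving `K` across the
tensor gives zero. -/
theorem isFlat_of_exact (M : RightMod R)
    (h : ∀ (ι : Type) [Fintype ι] (d : ℕ) (C : Matrix ι (Fin d) R),
      ∃ (a : ℕ) (A : Matrix (Fin a) ι R), Function.Exact (rowAct R A) (rowAct R C) ∧
        Function.Exact (rowAct M A) (rowAct M C)) : IsFlat M := by
  intro A B _ _ _ _ f hf
  rw [injective_iff_map_eq_zero]
  intro t ht
  obtain ⟨b, v, x, rfl⟩ := exists_tensorSum t
  rw [balancedTensorMap_tensorSum] at ht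
  obtain ⟨κ, _, m, d, C, z, hC, hz⟩ := exists_relations_of_tensorSum_eq_zero _ _ ht
  obtain ⟨a, K, hR, hM⟩ := h (Fin b ⊕ κ) d C
  obtain ⟨w, hw⟩ := (hM _).1 hC
  -- Padding `x` by zeros accounts for the extra rows, which represent relations.
  have h1 : tensorSum R v x = tensorSum R (Sum.elim v m) (Sum.elim x (0 : κ → A)) := by
    simp [tensorSum, Fintype.sum_sum_type]
  rw [h1, ← hw, tensorSum_rowAct]
  suffices ∀ i, ∑ j, K i j • (Sum.elim x (0 : κ → A)) j = 0 by simp [tensorSum, this]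
  intro i
  apply hf
  have h2 : ∀ j, f ((Sum.elim x (0 : κ → A)) j) = ∑ k, C j k • z k := by
    intro j
    rw [hz]
    rcases j with j | j <;> simp
  simp only [map_sum, map_smul, h2, Finset.smul_sum, smul_smul, map_zero]
  rw [Finset.sum_comm]
  simp only [← Finset.sum_smul]
  refine Finset.sum_eq_zero fun k _ => ?_
  have := congrFun (congrFun (mul_eq_zero_of_exact hR) i) k
  rw [Matrix.mul_apply] at this
  rw [this, Matrix.zero_apply, zero_smul]

end Flat

/-! ### Coherent modules -/

section Coherent

variable {S : Type*} [Ring S]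

/-- Finitely generated submodules of `X` are finitely presented. -/
def IsCoherentModule (S : Type*) [Ring S] (X : Type*) [AddCommGroup X] [Module S X] : Prop :=
  ∀ N : Submodule S X, N.FG → Module.FinitePresentation S N

variable {X Y : Type*} [AddCommGroup X] [Module S X] [AddCommGroup Y] [Module S Y]

theorem IsCoherentModule.of_injective (h : IsCoherentModule S Y) (f : X →ₗ[S] Y)
    (hf : Function.Injective f) : IsCoherentModule S X := fun N hN => by
  have := h _ (hN.map f)
  exact Module.FinitePresentation.of_equiv (N.equivMapOfInjective f hf).symm

theorem IsCoherentModule.fg_ker (h : IsCoherentModule S Y) [Module.Finite S X] (f : X →ₗ[S] Y) :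
    (LinearMap.ker f).FG := by
  have := h (LinearMap.range f) (by rw [LinearMap.range_eq_map]; exact Module.Finite.fg_top.map f)
  have := Module.FinitePresentation.fg_ker f.rangeRestrict f.surjective_rangeRestrict
  rwa [LinearMap.ker_rangeRestrict] at this

/-- A finitely generated submodule is an extension of its image in `X` by a kernel that embeds in
`Y`; the kernel is finitely generated because the image is finitely presented. -/
theorem IsCoherentModule.prod (hX : IsCoherentModule S X) (hY : IsCoherentModule S Y) :
    IsCoherentModule S (X × Y) := fun N hN => by
  have : Module.Finite S N := Module.Finite.iff_fg.2 hN
  let l : N →ₗ[S] X := LinearMap.fst S X Y ∘ₗ N.subtype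
  have h1 := hX (LinearMap.range l) (by
    rw [LinearMap.range_eq_map]; exact Module.Finite.fg_top.map l)
  have h2 : (LinearMap.ker l).FG := hX.fg_ker l
  let f : LinearMap.ker l →ₗ[S] Y := LinearMap.snd S X Y ∘ₗ N.subtype ∘ₗ (LinearMap.ker l).subtype
  have hf : Function.Injective f := by
    rintro ⟨⟨⟨x, y⟩, hx⟩, hx'⟩ ⟨⟨⟨x', y'⟩, hy⟩, hy'⟩ h
    simp only [l, f, LinearMap.mem_ker, LinearMap.comp_apply, Submodule.subtype_apply,
      LinearMap.fst_apply, LinearMap.snd_apply] at hx' hy' h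
    simp [hx', hy', h]
  have : Module.Finite S (LinearMap.ker l) := Module.Finite.iff_fg.2 h2
  have : Module.FinitePresentation S (LinearMap.ker l) := by
    have := hY (LinearMap.range f) (by
      rw [LinearMap.range_eq_map]; exact Module.Finite.fg_top.map f)
    exact Module.FinitePresentation.of_equiv (M := LinearMap.range f) (N := LinearMap.ker l)
      (LinearEquiv.ofInjective f hf).symm
  have : Module.FinitePresentation S (LinearMap.ker l.rangeRestrict) := by
    rwa [LinearMap.ker_rangeRestrict]
  exact Module.finitePresentation_of_ker l.rangeRestrict l.surjective_rangeRestrict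

theorem IsCoherentModule.pi (hX : IsCoherentModule S X) (ι : Type*) [Fintype ι] :
    IsCoherentModule S (ι → X) := by
  have h (m : ℕ) : IsCoherentModule S (Fin m → X) := by
    induction m with
    | zero =>
      refine hX.of_injective 0 fun x y _ => Subsingleton.elim _ _
    | succ m ih =>
      refine (hX.prod ih).of_injective
        ((LinearMap.proj 0).prod (LinearMap.funLeft S X Fin.succ)) fun x y hxy => ?_
      ext i
      refine Fin.cases (congrArg Prod.fst hxy) (fun j => ?_) i
      exact congrFun (congrArg Prod.snd hxy) j
  exact (h _).of_injective (LinearEquiv.funCongrLeft S X (Fintype.equivFin ι).symm).toLinearMap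
    (LinearEquiv.injective _)

end Coherent

/-! ### Resolutions by finitely generated free modules -/

section Resolutions

variable {R : Type u} [Ring R]

/-- `R` as a right module over itself is free of rank one. -/
def opSelfEquiv (R : Type u) [Ring R] : Rᵐᵒᵖ ≃ₗ[Rᵐᵒᵖ] R where
  toFun := MulOpposite.unop
  invFun := MulOpposite.op
  map_add' _ _ := rfl
  map_smul' _ _ := rfl
  left_inv _ := rfl
  right_inv _ := rfl

instance : Module.Finite Rᵐᵒᵖ R := Module.Finite.equiv (opSelfEquiv R)

instance : Module.Free Rᵐᵒᵖ R := Module.Free.of_equiv (opSelfEquiv R)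

theorem exists_exact_rowAct (hR : IsLeftCoherent R) {ι κ : Type} [Fintype ι] [Fintype κ]
    (C : Matrix ι κ R) :
    ∃ (a : ℕ) (A : Matrix (Fin a) ι R), Function.Exact (rowAct R A) (rowAct R C) := by
  have hc : IsCoherentModule R R := hR
  obtain ⟨a, s, hs⟩ := Submodule.fg_iff_exists_fin_generating_family.1
    ((hc.pi κ).fg_ker (rowMap C))
  refine ⟨a, Matrix.of s, fun v => ?_⟩
  rw [← rowMap_apply, ← LinearMap.mem_ker, ← hs, Submodule.mem_span_range_iff_exists_fun]
  refine exists_congr fun c => Eq.congr_left ?_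
  ext j
  simp [rowAct_apply]

theorem exists_exact_colMap (hR : IsRightCoherent R) {ι κ : Type} [Fintype ι] [Fintype κ]
    (C : Matrix κ ι R) :
    ∃ (a : ℕ) (A : Matrix ι (Fin a) R), Function.Exact (colMap A) (colMap C) := by
  have hc : IsCoherentModule Rᵐᵒᵖ R := hR
  obtain ⟨a, s, hs⟩ := Submodule.fg_iff_exists_fin_generating_family.1
    ((hc.pi κ).fg_ker (colMap C))
  refine ⟨a, Matrix.of fun i j => s j i, fun v => ?_⟩
  rw [← LinearMap.mem_ker, ← hs, Submodule.mem_span_range_iff_exists_fun]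
  have h (c : Fin a → R) : ∑ i, MulOpposite.op (c i) • s i =
      colMap (Matrix.of fun i j => s j i) c := by
    ext j
    simp [Matrix.mulVec, dotProduct]
  constructor
  · rintro ⟨c, rfl⟩
    exact ⟨fun i => (c i).unop, by rw [← h]; rfl⟩
  · rintro ⟨c, rfl⟩
    exact ⟨fun i => MulOpposite.op (c i), h c⟩

/-- Dependent choice for sequences of composable arrows prolonged on one side. -/
theorem exists_sequence {T : ℕ → ℕ → Type*} (r : ∀ {a b c : ℕ}, T a b → T b c → Prop)
    (h : ∀ {b c : ℕ} (C : T b c), ∃ (a : ℕ) (A : T a b), r A C) {b c : ℕ} (C : T b c) :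
    ∃ (a : ℕ → ℕ) (A : ∀ k, T (a (k + 1)) (a k)), (∀ k, r (A (k + 1)) (A k)) ∧
      (⟨a 1, a 0, A 0⟩ : Σ b c, T b c) = ⟨b, c, C⟩ := by
  choose f g hfg using @h
  let step (x : Σ b c, T b c) : Σ b c, T b c := ⟨f x.2.2, x.1, g x.2.2⟩
  let s (k : ℕ) : Σ b c, T b c := k.rec ⟨b, c, C⟩ fun _ => step
  exact ⟨fun k => (s k).2.1, fun k => (s k).2.2, fun k => hfg (s k).2.2, rfl⟩

theorem exists_colEval_surjective (F : Type u) [AddCommGroup F] [Module Rᵐᵒᵖ F]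
    [Module.Finite Rᵐᵒᵖ F] :
    ∃ (a : ℕ) (v : Fin a → F), Function.Surjective (colEval (R := R) v) := by
  obtain ⟨a, s, hs⟩ := Submodule.fg_iff_exists_fin_generating_family.1
    (Module.Finite.fg_top : (⊤ : Submodule Rᵐᵒᵖ F).FG)
  refine ⟨a, s, fun x => ?_⟩
  obtain ⟨c, hc⟩ := (Submodule.mem_span_range_iff_exists_fun _).1
    (show x ∈ Submodule.span Rᵐᵒᵖ (Set.range s) by rw [hs]; trivial)
  exact ⟨fun i => (c i).unop, hc⟩

/-- A finitely presented right module over a right coherent ring has a resolution by finitely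
generated free modules. -/
theorem exists_resolution (hR : IsRightCoherent R) (F : Type u) [AddCommGroup F] [Module Rᵐᵒᵖ F]
    [Module.FinitePresentation Rᵐᵒᵖ F] :
    ∃ (a : ℕ → ℕ) (B : ∀ k, Matrix (Fin (a k)) (Fin (a (k + 1))) R) (v : Fin (a 0) → F),
      (∀ k, Function.Exact (colMap (B (k + 1))) (colMap (B k))) ∧
      Function.Exact (colMap (B 0)) (colEval (R := R) v) ∧
      Function.Surjective (colEval (R := R) v) := by
  obtain ⟨c, v, hv⟩ := exists_colEval_surjective (R := R) F
  obtain ⟨b, s, hs⟩ := Submodule.fg_iff_exists_fin_generating_family.1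
    (Module.FinitePresentation.fg_ker (colEval (R := R) v) hv)
  let C : Matrix (Fin c) (Fin b) R := Matrix.of fun i j => s j i
  have hC : Function.Exact (colMap C) (colEval (R := R) v) := by
    intro x
    rw [← LinearMap.mem_ker, ← hs, Submodule.mem_span_range_iff_exists_fun]
    have h (c : Fin b → R) : ∑ i, MulOpposite.op (c i) • s i = colMap C c := by
      ext j
      simp [Matrix.mulVec, dotProduct, C]
    constructor
    · rintro ⟨c, rfl⟩
      exact ⟨fun i => (c i).unop, by rw [← h]; rfl⟩
    · rintro ⟨c, rfl⟩
      exact ⟨fun i => MulOpposite.op (c i), h c⟩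
  obtain ⟨a, B, hB, h0⟩ := exists_sequence (T := fun a b => Matrix (Fin b) (Fin a) R)
    (fun A B => Function.Exact (colMap A) (colMap B)) (fun C => exists_exact_colMap hR C) C
  clear_value C
  obtain ⟨rfl, h0⟩ := Sigma.mk.inj_iff.1 h0
  obtain ⟨rfl, h0⟩ := Sigma.mk.inj_iff.1 (eq_of_heq h0)
  obtain rfl := eq_of_heq h0
  exact ⟨a, B, v, hB, hC, hv⟩

theorem exists_comp_eq_of_ker_le {S X Y Z : Type*} [Ring S] [AddCommGroup X] [AddCommGroup Y]
    [AddCommGroup Z] [Module S X] [Module S Y] [Module S Z] (f : X →ₗ[S] Y)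
    (hf : Function.Surjective f) (φ : X →ₗ[S] Z) (h : LinearMap.ker f ≤ LinearMap.ker φ) :
    ∃ g : Y →ₗ[S] Z, g ∘ₗ f = φ := by
  refine ⟨(LinearMap.ker f).liftQ φ h ∘ₗ (f.quotKerEquivOfSurjective hf).symm.toLinearMap, ?_⟩
  ext x
  have : (f.quotKerEquivOfSurjective hf).symm (f x) = Submodule.Quotient.mk x := by
    rw [LinearEquiv.symm_apply_eq]; rfl
  simp [this]

open Abelian in
/-- `Ext^{k+1}(F, N) = 0` read off from a projective resolution of `F`. -/
theorem subsingleton_ext_iff {S : Type u} [Ring S] (N : ModuleCat.{u} S) (k : ℕ)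
    (P : ℕ → Type u) [∀ k, AddCommGroup (P k)] [∀ k, Module S (P k)]
    [hP : ∀ k, Module.Projective S (P k)] (d : ∀ k, P (k + 1) →ₗ[S] P k)
    (hd : ∀ k, Function.Exact (d (k + 1)) (d k)) (F : Type u) [AddCommGroup F] [Module S F]
    (p : P 0 →ₗ[S] F) (hp : Function.Surjective p) (hdp : Function.Exact (d 0) p) :
    Subsingleton (Ext (ModuleCat.of S F) N (k + 1)) ↔
      ∀ φ : P (k + 1) →ₗ[S] N, φ ∘ₗ d (k + 1) = 0 → ∃ ψ : P k →ₗ[S] N, ψ ∘ₗ d k = φ := by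
  induction k generalizing P F with
  | zero =>
    have hS := shortExact_submodule (LinearMap.range (d 0)) p (LinearMap.exact_iff.1 hdp) hp
    have : Projective (ModuleCat.of S (P 0)) := (IsProjective.iff_projective _).1 (hP 0)
    constructor
    · intro h φ hφ
      obtain ⟨g, rfl⟩ := exists_comp_eq_of_ker_le (d 0).rangeRestrict
        (d 0).surjective_rangeRestrict φ (by
          rw [LinearMap.ker_rangeRestrict, LinearMap.exact_iff.1 (hd 0)]
          rintro _ ⟨x, rfl⟩
          exact LinearMap.congr_fun hφ x)
      obtain ⟨ψ, hψ⟩ := exists_extension_of_ext hS N h (ModuleCat.ofHom g)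
      refine ⟨ψ.hom, ?_⟩
      ext x
      exact LinearMap.congr_fun (ModuleCat.hom_ext_iff.1 hψ) ((d 0).rangeRestrict x)
    · intro h
      refine subsingleton_ext_of_extension hS N (Ext.subsingleton_of_projective _ _ _) fun φ => ?_
      obtain ⟨ψ, hψ⟩ := h (φ.hom ∘ₗ (d 0).rangeRestrict) (by
        ext x
        have : (d 0).rangeRestrict (d 1 x) = 0 := Subtype.ext ((hd 0 _).2 ⟨x, rfl⟩)
        simp [this])
      refine ⟨ModuleCat.ofHom ψ, ?_⟩
      ext ⟨_, x, rfl⟩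
      exact LinearMap.congr_fun hψ x
  | succ k ih =>
    have hS := shortExact_submodule (LinearMap.range (d 0)) p (LinearMap.exact_iff.1 hdp) hp
    have : Projective (ModuleCat.of S (P 0)) := (IsProjective.iff_projective _).1 (hP 0)
    -- Dimension shift: the complex without `P 0` resolves the range of `d 0`.
    rw [← ih (fun k => P (k + 1)) (fun k => d (k + 1)) (fun k => hd (k + 1)) _
      (d 0).rangeRestrict (d 0).surjective_rangeRestrict (by
        rw [LinearMap.exact_iff, LinearMap.ker_rangeRestrict]
        exact LinearMap.exact_iff.1 (hd 0))]
    exact ⟨fun h => subsingleton_ext_X₁_of_contravariant hS N (k + 1)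
        (Ext.subsingleton_of_projective _ _ _) h,
      fun h => subsingleton_ext_X₃_of_contravariant hS N (k + 1) h
        (Ext.subsingleton_of_projective _ _ _)⟩

end Resolutions

open Abelian

/-! ### Finite FP-injective dimension versus finite flat dimension -/

section FPInjective

/-- `Ext^{n+1}(F, N) = 0` for all finitely presented `F`. -/
def FPInjDimLE {S : Type u} [Ring S] (n : ℕ) (N : ModuleCat.{u} S) : Prop :=
  ∀ F : ModuleCat.{u} S, Module.FinitePresentation S F → Subsingleton (Ext F N (n + 1))

theorem exists_mem_of_sInf_lt_top {p : ℕ → Prop} (h : sInf {d : ℕ∞ | ∃ n : ℕ, d = n ∧ p n} < ⊤) :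
    ∃ n : ℕ, sInf {d : ℕ∞ | ∃ n : ℕ, d = n ∧ p n} = n ∧ p n := by
  refine csInf_mem (s := {d : ℕ∞ | ∃ n : ℕ, d = n ∧ p n}) ?_
  by_contra hne
  rw [Set.not_nonempty_iff_eq_empty.1 hne, sInf_empty] at h
  exact lt_irrefl _ h

theorem sInf_lt_top_of_mem {p : ℕ → Prop} {n : ℕ} (h : p n) :
    sInf {d : ℕ∞ | ∃ n : ℕ, d = n ∧ p n} < ⊤ :=
  lt_of_le_of_lt (sInf_le (show (n : ℕ∞) ∈ {d : ℕ∞ | ∃ n : ℕ, d = n ∧ p n} from ⟨n, rfl, h⟩))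
    (ENat.natCast_lt_top n)

theorem fpInjDim_lt_top_iff {S : Type u} [Ring S] (N : ModuleCat.{u} S) :
    fpInjDim N < ⊤ ↔ ∃ n, FPInjDimLE n N :=
  ⟨fun h => (exists_mem_of_sInf_lt_top h).imp fun _ h => h.2, fun ⟨_, h⟩ => sInf_lt_top_of_mem h⟩

theorem fpInjDimLE_of_eq {S : Type u} [Ring S] {N : ModuleCat.{u} S} {n : ℕ}
    (h : fpInjDim N = n) : FPInjDimLE n N := by
  obtain ⟨m, hm, h'⟩ := exists_mem_of_sInf_lt_top
    (show fpInjDim N < ⊤ by rw [h]; exact ENat.natCast_lt_top n)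
  obtain rfl : n = m := by
    rw [← Nat.cast_inj (R := ℕ∞), ← hm]
    exact h.symm
  exact h'

theorem flatDim_lt_top_iff {R : Type u} [Ring R] (N : RightMod R) :
    flatDim N < ⊤ ↔ ∃ n, HasFlatResolution n N :=
  ⟨fun h => (exists_mem_of_sInf_lt_top h).imp fun _ h => h.2, fun ⟨_, h⟩ => sInf_lt_top_of_mem h⟩

variable {R : Type u} [Ring R]

theorem colMap_comp_colMap {ι κ ℓ : ℕ} {A : Matrix (Fin ι) (Fin κ) R} {B : Matrix (Fin κ) (Fin ℓ) R}
    (h : Function.Exact (colMap B) (colMap A)) : colMap A ∘ₗ colMap B = 0 :=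
  LinearMap.ext fun x => (h _).2 ⟨x, rfl⟩

theorem subsingleton_ext_iff_rowAct (N : RightMod R) (k : ℕ) {a : ℕ → ℕ}
    {B : ∀ k, Matrix (Fin (a k)) (Fin (a (k + 1))) R} {F : Type u} [AddCommGroup F]
    [Module Rᵐᵒᵖ F] {v : Fin (a 0) → F}
    (hB : ∀ k, Function.Exact (colMap (B (k + 1))) (colMap (B k)))
    (h0 : Function.Exact (colMap (B 0)) (colEval (R := R) v))
    (hv : Function.Surjective (colEval (R := R) v)) :
    Subsingleton (Ext (ModuleCat.of Rᵐᵒᵖ F) N (k + 1)) ↔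
      Function.Exact (rowAct N (B k)) (rowAct N (B (k + 1))) := by
  rw [subsingleton_ext_iff N k (fun k => Fin (a k) → R) (fun k => colMap (B k)) hB F _ hv h0]
  constructor
  · intro h x
    constructor
    · intro hx
      obtain ⟨ψ, hψ⟩ := h (colEval x) (by
        rw [colEval_comp_colMap, hx]; ext; simp [colEval_apply])
      obtain ⟨y, rfl⟩ := colEval_bijective.2 ψ
      rw [colEval_comp_colMap] at hψ
      exact ⟨y, colEval_bijective.1 hψ⟩
    · rintro ⟨y, rfl⟩
      apply (colEval_bijective (R := R)).1
      rw [← colEval_comp_colMap, ← colEval_comp_colMap, LinearMap.comp_assoc,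
        colMap_comp_colMap (hB k)]
      ext; simp [colEval_apply]
  · intro h φ hφ
    obtain ⟨x, rfl⟩ := colEval_bijective.2 φ
    obtain ⟨y, rfl⟩ := (h x).1 (by
      apply (colEval_bijective (R := R)).1
      rw [← colEval_comp_colMap, hφ]
      ext; simp [colEval_apply])
    exact ⟨colEval y, colEval_comp_colMap _ _⟩

/-- Ext vanishing for R is exactness of two matrices over R, and flatness carries this over to N. -/
theorem IsFlat.fpInjDimLE {n : ℕ} (hR : IsRightCoherent R)
    (hn : FPInjDimLE n (ModuleCat.of Rᵐᵒᵖ R)) {N : RightMod R} (hN : IsFlat N) :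
    FPInjDimLE n N := by
  intro F hF
  obtain ⟨a, B, v, hB, h0, hv⟩ := exists_resolution hR F
  exact (subsingleton_ext_iff_rowAct N n hB h0 hv).2 (exact_rowAct_of_isFlat hN
    ((subsingleton_ext_iff_rowAct (ModuleCat.of Rᵐᵒᵖ R) n hB h0 hv).1 (hn _ hF)))

/-- By coherence, the first syzygy of a finitely presented module is again finitely presented. -/
theorem FPInjDimLE.succ {n : ℕ} (hR : IsRightCoherent R) {N : RightMod R} (hN : FPInjDimLE n N) :
    FPInjDimLE (n + 1) N := by
  intro F hF
  obtain ⟨a, v, hv⟩ := exists_colEval_surjective (R := R) F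
  have hc : IsCoherentModule Rᵐᵒᵖ R := hR
  have hS := shortExact_submodule _ (colEval (R := R) v) rfl hv
  have : Projective (ModuleCat.of Rᵐᵒᵖ (Fin a → R)) :=
    (IsProjective.iff_projective _).1 inferInstance
  exact subsingleton_ext_X₃_of_contravariant hS N (n + 1)
    (hN _ ((hc.pi _) _ (Module.FinitePresentation.fg_ker _ hv)))
    (Ext.subsingleton_of_projective _ _ _)

theorem shortExact_of_hom {S : Type u} [Ring S] {X Y Z : ModuleCat.{u} S} (i : X ⟶ Y) (p : Y ⟶ Z)
    (hi : Function.Injective i) (hip : Function.Exact i p) (hp : Function.Surjective p) :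
    (ShortComplex.mk i p (by ext x; exact (hip (i x)).2 ⟨x, rfl⟩)).ShortExact :=
  shortExact_of_linearMap i.hom p.hom hi hip hp

/-- Ext^{n+1}(G, N) lies between Ext^{n+1}(G, F) and Ext^{n+2}(G, K), so the bound n does not grow
with the length of the resolution. -/
theorem HasFlatResolution.fpInjDimLE {n : ℕ} (hR : IsRightCoherent R)
    (hn : FPInjDimLE n (ModuleCat.of Rᵐᵒᵖ R)) {k : ℕ} {N : RightMod R}
    (hN : HasFlatResolution k N) : FPInjDimLE n N := by
  induction k generalizing N with
  | zero => exact IsFlat.fpInjDimLE hR hn hN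
  | succ k ih =>
    obtain ⟨K, F, i, p, hi, hip, hp, hF, hK⟩ := hN
    intro G hG
    exact subsingleton_ext_X₃_of_covariant (shortExact_of_hom i p hi hip hp) G (n + 1)
      (hF.fpInjDimLE hR hn G hG) ((ih hK).succ hR G hG)

/-- `Tor_{j+1}(N, -)` vanishes on finitely presented left modules with a resolution by finitely
generated free modules. -/
def TorVanishes (j : ℕ) (N : RightMod R) : Prop :=
  ∀ (a : ℕ → ℕ) (A : ∀ k, Matrix (Fin (a (k + 1))) (Fin (a k)) R),
    (∀ k, Function.Exact (rowAct R (A (k + 1))) (rowAct R (A k))) →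
      Function.Exact (rowAct N (A (j + 1))) (rowAct N (A j))

/-- The matrices from `A j` on resolve the finitely presented cokernel of `A j`; the claim is
Ext^{n+1} of it into R being zero. -/
theorem exact_colMap_of_fpInjDimLE {n : ℕ} (hn : FPInjDimLE n (ModuleCat.of R R)) {a : ℕ → ℕ}
    {A : ∀ k, Matrix (Fin (a (k + 1))) (Fin (a k)) R}
    (hA : ∀ k, Function.Exact (rowAct R (A (k + 1))) (rowAct R (A k))) (j : ℕ) :
    Function.Exact (colMap (A (j + n))) (colMap (A (j + (n + 1)))) := by
  let L := LinearMap.range (rowMap (A j))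
  have hfp : Module.FinitePresentation R ((Fin (a j) → R) ⧸ L) :=
    Module.finitePresentation_of_surjective L.mkQ L.mkQ_surjective (by
      rw [Submodule.ker_mkQ, show L = LinearMap.range (rowMap (A j)) from rfl,
        LinearMap.range_eq_map]
      exact Module.Finite.fg_top.map _)
  have h := (subsingleton_ext_iff (ModuleCat.of R R) n (fun k => Fin (a (j + k)) → R)
    (fun k => rowMap (A (j + k))) (fun k => hA (j + k)) _ L.mkQ L.mkQ_surjective
    (LinearMap.exact_iff.2 (by rw [Submodule.ker_mkQ]; rfl))).1 (hn _ hfp)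
  intro y
  constructor
  · intro hy
    obtain ⟨ψ, hψ⟩ := h (rowEval y) (by
      have : colMap (A (j + (n + 1))) y = 0 := hy
      refine (rowEval_comp_rowMap y _).trans ?_
      rw [this]; ext; simp [rowEval_apply])
    obtain ⟨z, rfl⟩ := rowEval_bijective.2 ψ
    refine ⟨z, rowEval_bijective.1 ?_⟩
    rw [← hψ]
    exact (rowEval_comp_rowMap z _).symm
  · rintro ⟨z, rfl⟩
    apply rowEval_bijective.1
    rw [← rowEval_comp_rowMap]
    have := rowEval_comp_rowMap z (A (j + n))
    rw [← this, LinearMap.comp_assoc]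
    have h0 : rowMap (A (j + n)) ∘ₗ rowMap (A (j + (n + 1))) = 0 :=
      LinearMap.ext fun x => (hA (j + n) _).2 ⟨x, rfl⟩
    refine (congrArg (rowEval z ∘ₗ ·) h0).trans ?_
    ext; simp [rowEval_apply]

/-- The dual complex is exact from degree n on, so its cokernel `C k` embeds in a free module with
cokernel `C (k + 1)`. Hence Ext¹(C_k, N) reduces to Ext^{m+1}(C_{k+m}, N) = 0, whatever the finite
m. -/
theorem FPInjDimLE.torVanishes {n m : ℕ} (hn : FPInjDimLE n (ModuleCat.of R R)) {N : RightMod R}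
    (hN : FPInjDimLE m N) : TorVanishes n N := by
  intro a A hA
  have hcol (j : ℕ) : Function.Exact (colMap (A (n + j))) (colMap (A (n + j + 1))) := by
    have h : ∀ i, i = j + n → Function.Exact (colMap (A i)) (colMap (A (i + 1))) := by
      rintro _ rfl
      exact exact_colMap_of_fpInjDimLE hn hA j
    exact h _ (add_comm n j)
  let L (k : ℕ) := LinearMap.range (colMap (A (n + k)))
  let C (k : ℕ) : RightMod R := ModuleCat.of Rᵐᵒᵖ ((Fin (a (n + k + 1)) → R) ⧸ L k)
  have hL (k : ℕ) : LinearMap.ker (colMap (A (n + k + 1))) = L k := LinearMap.exact_iff.1 (hcol k)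
  let f (k : ℕ) : ((Fin (a (n + k + 1)) → R) ⧸ L k) →ₗ[Rᵐᵒᵖ] (Fin (a (n + k + 2)) → R) :=
    (L k).liftQ (colMap (A (n + k + 1))) (hL k).ge
  have hf (k : ℕ) : Function.Injective (f k) := by
    rw [← LinearMap.ker_eq_bot, Submodule.ker_liftQ_eq_bot]
    exact (hL k).le
  have hfg (k : ℕ) : Function.Exact (f k) (L (k + 1)).mkQ := by
    rw [LinearMap.exact_iff, Submodule.ker_mkQ, Submodule.range_liftQ]
    rfl
  have hS (k : ℕ) := shortExact_of_linearMap (f k) (L (k + 1)).mkQ (hf k) (hfg k)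
    (L (k + 1)).mkQ_surjective
  have hfree (b : ℕ) : Module.FinitePresentation Rᵐᵒᵖ (Fin b → R) :=
    Module.finitePresentation_of_projective _ _
  have hfp (k : ℕ) : Module.FinitePresentation Rᵐᵒᵖ (C k) :=
    Module.finitePresentation_of_surjective (L k).mkQ (L k).mkQ_surjective (by
      rw [Submodule.ker_mkQ, show L k = LinearMap.range _ from rfl, LinearMap.range_eq_map]
      exact Module.Finite.fg_top.map _)
  have hproj (b : ℕ) : Projective (ModuleCat.of Rᵐᵒᵖ (Fin b → R)) :=
    (IsProjective.iff_projective _).1 inferInstance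
  have hshift (i k : ℕ) : Subsingleton (Ext (C (k + i)) N (i + 1)) →
      Subsingleton (Ext (C k) N 1) := by
    induction i with
    | zero => exact id
    | succ i ih =>
      exact fun h => ih (subsingleton_ext_X₁_of_contravariant (hS (k + i)) N (i + 1)
        (Ext.subsingleton_of_projective _ _ _) h)
  have hext := hshift m 1 (hN _ (hfp _))
  intro v
  constructor
  · intro hv
    -- A row vector killed by `A n` is a map `C 0` → N; extending it to the free module containing
    -- `C 0` yields a preimage under `A (n + 1)`.
    obtain ⟨ψ, hψ⟩ := exists_extension_of_ext (hS 0) N hext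
      (ModuleCat.ofHom ((L 0).liftQ (colEval v) (by
        rintro _ ⟨x, rfl⟩
        have h := colEval_comp_colMap v (A n)
        rw [show rowAct N (A n) v = 0 from hv] at h
        exact (LinearMap.congr_fun h x).trans (by simp [colEval_apply]))))
    obtain ⟨w, hw⟩ := colEval_bijective.2 ψ.hom
    refine ⟨w, (colEval_bijective (R := R)).1 ?_⟩
    rw [← colEval_comp_colMap, hw]
    refine LinearMap.ext fun x => ?_
    exact LinearMap.congr_fun (ModuleCat.hom_ext_iff.1 hψ) ((L 0).mkQ x)
  · rintro ⟨w, rfl⟩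
    rw [rowAct_rowAct, mul_eq_zero_of_exact (hA n)]
    ext; simp [rowAct_apply]

theorem TorVanishes.exists_exact_rowAct (hR : IsLeftCoherent R) {N : RightMod R}
    (hN : TorVanishes 0 N) {c d : ℕ} (C : Matrix (Fin c) (Fin d) R) :
    ∃ (b : ℕ) (B : Matrix (Fin b) (Fin c) R), Function.Exact (rowAct R B) (rowAct R C) ∧
      Function.Exact (rowAct N B) (rowAct N C) := by
  obtain ⟨a, A, hA, h0⟩ := exists_sequence (T := fun a b => Matrix (Fin a) (Fin b) R)
    (fun A B => Function.Exact (rowAct R A) (rowAct R B))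
    (fun C => DingChen.exists_exact_rowAct hR C) C
  obtain ⟨rfl, h0⟩ := Sigma.mk.inj_iff.1 h0
  obtain ⟨rfl, h0⟩ := Sigma.mk.inj_iff.1 (eq_of_heq h0)
  obtain rfl := eq_of_heq h0
  exact ⟨_, A 1, hA 0, hN a A hA⟩

theorem isFlat_of_torVanishes (hR : IsLeftCoherent R) {N : RightMod R} (hN : TorVanishes 0 N) :
    IsFlat N := by
  refine isFlat_of_exact N fun ι _ d C => ?_
  let e := Fintype.equivFin ι
  obtain ⟨b, B, hB, hB'⟩ := hN.exists_exact_rowAct hR (C.submatrix e.symm id)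
  have h1 (N : Type u) [AddCommGroup N] [Module Rᵐᵒᵖ N] (v : ι → N) :
      rowAct N (C.submatrix e.symm id) (v ∘ e.symm) = rowAct N C v := by
    ext j
    exact e.symm.sum_comp (fun i => MulOpposite.op (C i j) • v i)
  have h2 (N : Type u) [AddCommGroup N] [Module Rᵐᵒᵖ N]
      (h : Function.Exact (rowAct N B) (rowAct N (C.submatrix e.symm id))) :
      Function.Exact (rowAct N (B.submatrix id e)) (rowAct N C) := by
    intro v
    rw [← h1, h]
    refine exists_congr fun w => ?_
    constructor
    · intro hw
      ext i
      have := congrFun hw (e i)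
      simpa [rowAct_apply] using this
    · rintro rfl
      ext i
      simp [rowAct_apply]
  exact ⟨b, B.submatrix id e, h2 R hB, h2 N hB'⟩

theorem torVanishes_finsupp (X : Type u) (j : ℕ) :
    TorVanishes j (ModuleCat.of Rᵐᵒᵖ (X →₀ R)) := by
  classical
  intro a A hA v
  have hcoord (b c : ℕ) (B : Matrix (Fin b) (Fin c) R) (v : Fin b → X →₀ R) (x : X) :
      rowAct R B (fun i => v i x) = fun j => rowAct (X →₀ R) B v j x := by
    ext j
    simp [rowAct_apply, Finsupp.finsetSum_apply]
  constructor
  · intro hv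
    -- Choosing the zero preimage wherever `v` vanishes keeps the supports finite.
    have h (x : X) : ∃ w : Fin (a (j + 1 + 1)) → R,
        rowAct R (A (j + 1)) w = (fun i => v i x) ∧ ((fun i => v i x) = 0 → w = 0) := by
      by_cases hx : (fun i => v i x) = 0
      · exact ⟨0, by rw [map_zero, hx], fun _ => rfl⟩
      · obtain ⟨w, hw⟩ := (hA j (fun i => v i x)).1 (by
          rw [hcoord]
          ext i
          exact DFunLike.congr_fun (congrFun hv i) x)
        exact ⟨w, hw, fun h => absurd h hx⟩
    choose w hw hw0 using h
    refine ⟨fun i => Finsupp.onFinset (Finset.univ.biUnion fun i => (v i).support)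
      (fun x => w x i) fun x hx => ?_, ?_⟩
    · by_contra hmem
      refine hx (congrFun (hw0 x ?_) i)
      ext i'
      by_contra hi
      exact hmem (Finset.mem_biUnion.2 ⟨i', Finset.mem_univ _, Finsupp.mem_support_iff.2 hi⟩)
    · funext i
      ext x
      refine (congrFun (hcoord _ _ _ _ x) i).symm.trans ?_
      exact congrFun (hw x) i
  · rintro ⟨w, rfl⟩
    rw [rowAct_rowAct, mul_eq_zero_of_exact (hA j)]
    ext; simp [rowAct_apply]

/-- The diagram chase placing Tor_{j+1}(K) between Tor_{j+2}(N) and Tor_{j+1}(F). -/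
theorem TorVanishes.shift {j : ℕ} {K F N : RightMod R} {i : K ⟶ F} {p : F ⟶ N}
    (hi : Function.Injective i) (hip : Function.Exact i p) (hp : Function.Surjective p)
    (hF : TorVanishes j F) (hN : TorVanishes (j + 1) N) : TorVanishes j K := by
  intro a A hA v
  constructor
  · intro hv
    obtain ⟨y, hy⟩ := (hF a A hA (i ∘ v)).1 (by
      refine (rowAct_map i.hom _ v).trans ?_
      rw [hv]; ext; simp)
    obtain ⟨z, hz⟩ := (hN a A hA (p ∘ y)).1 (by
      refine (rowAct_map p.hom _ y).trans ?_
      rw [hy]; ext k; exact (hip _).2 ⟨_, rfl⟩)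
    choose z' hz' using fun k => hp (z k)
    have hu (k) : ∃ u, i u = (y - rowAct F (A (j + 2)) z') k := by
      refine (hip _).1 ?_
      have h1 : rowAct N (A (j + 2)) (p ∘ z') = p ∘ rowAct F (A (j + 2)) z' :=
        rowAct_map p.hom _ z'
      rw [show p ∘ z' = z from funext hz'] at h1
      rw [Pi.sub_apply, map_sub, sub_eq_zero]
      exact (congrFun hz k).symm.trans (congrFun h1 k)
    choose u hu using hu
    refine ⟨u, ?_⟩
    ext k
    apply hi
    have h1 : rowAct F (A (j + 1)) (i ∘ u) = i ∘ rowAct K (A (j + 1)) u := rowAct_map i.hom _ u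
    have h2 : rowAct F (A (j + 1)) (i ∘ u) = i ∘ v := by
      rw [show i ∘ u = y - rowAct F (A (j + 2)) z' from funext hu, map_sub, hy, rowAct_rowAct,
        mul_eq_zero_of_exact (hA (j + 1))]
      ext; simp [rowAct_apply]
    exact congrFun (h1.symm.trans h2) k
  · rintro ⟨w, rfl⟩
    rw [rowAct_rowAct, mul_eq_zero_of_exact (hA j)]
    ext; simp [rowAct_apply]

/-- The free cover of a right module. -/
noncomputable def freeCover (N : Type u) [AddCommGroup N] [Module Rᵐᵒᵖ N] : (N →₀ R) →ₗ[Rᵐᵒᵖ] N :=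
  Finsupp.lsum ℕ fun n =>
    LinearMap.toSpanSingleton Rᵐᵒᵖ N n ∘ₗ (opSelfEquiv R).symm.toLinearMap

theorem freeCover_surjective (N : Type u) [AddCommGroup N] [Module Rᵐᵒᵖ N] :
    Function.Surjective (freeCover (R := R) N) := fun n =>
  ⟨Finsupp.single n 1, by
    simp [freeCover, show (opSelfEquiv R).symm 1 = 1 from rfl]⟩

theorem TorVanishes.hasFlatResolution (hR : IsLeftCoherent R) {n : ℕ} {N : RightMod R}
    (hN : TorVanishes n N) : HasFlatResolution n N := by
  induction n generalizing N with
  | zero => exact isFlat_of_torVanishes hR hN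
  | succ n ih =>
    let p := freeCover (R := R) N
    let i := (LinearMap.ker p).subtype
    have hi : Function.Injective i := Subtype.val_injective
    have hip : Function.Exact i p := p.exact_subtype_ker_map
    exact ⟨ModuleCat.of _ (LinearMap.ker p), ModuleCat.of _ (N →₀ R), ModuleCat.ofHom i,
      ModuleCat.ofHom p, hi, hip, freeCover_surjective _,
      isFlat_of_torVanishes hR (torVanishes_finsupp _ 0),
      ih (TorVanishes.shift (i := ModuleCat.ofHom i) (p := ModuleCat.ofHom p) hi hip
        (freeCover_surjective _) (torVanishes_finsupp _ n) hN)⟩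

theorem IsNFCRing.hasFlatResolution {n m : ℕ} (hR : IsNFCRing R n) {N : RightMod R}
    (hN : FPInjDimLE m N) : HasFlatResolution n N :=
  (FPInjDimLE.torVanishes (fpInjDimLE_of_eq hR.fpInjDim_left) hN).hasFlatResolution hR.leftCoherent

theorem IsNFCRing.fpInjDimLE {n k : ℕ} (hR : IsNFCRing R n) {N : RightMod R}
    (hN : HasFlatResolution k N) : FPInjDimLE n N :=
  hN.fpInjDimLE hR.rightCoherent (fpInjDimLE_of_eq hR.fpInjDim_right)

end FPInjective

open Abelian Limits ZeroObject

/-! ### Special preenvelopes from the small object argument -/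

section SmallObject

universe w v v'

variable {S : Type u} [Ring S]

/-- Attaching cells along monomorphisms gives monomorphisms, and the `A i` are small for chains of
these once κ exceeds their numbers of subobjects. -/
theorem hasSmallObjectArgument_ofHoms {C : Type v'} [Category.{v} C] [Abelian C]
    [IsGrothendieckAbelian.{w} C] {ι : Type w} {A B : ι → C} (f : ∀ i, A i ⟶ B i)
    (hf : ∀ i, Mono (f i)) :
    MorphismProperty.HasSmallObjectArgument.{w} (MorphismProperty.ofHoms f) := by
  obtain ⟨κ, hκ', hκ⟩ := HasCardinalLT.exists_regular_cardinal_forall.{w}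
    fun i => Subobject (A i)
  have : Fact κ.IsRegular := ⟨hκ'⟩
  have : Nonempty κ.ord.ToType := by simpa using hκ'.ne_zero
  have := WellFoundedLT.toOrderBot κ.ord.ToType
  exact ⟨κ, inferInstance, inferInstance,
    { preservesColimit {A' B' X Y} i hi f' hf' := by
        let hf'' : (MorphismProperty.monomorphisms C).TransfiniteCompositionOfShape
            κ.ord.ToType f' :=
          { toTransfiniteCompositionOfShape := hf'.toTransfiniteCompositionOfShape
            map_mem j hj := by
              have := (hf'.attachCells j hj).pushouts_coproducts
              simp only [MorphismProperty.ofHoms_homFamily] at this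
              refine (?_ : _ ≤ MorphismProperty.monomorphisms C) _ this
              simp only [MorphismProperty.pushouts_le_iff, MorphismProperty.coproducts_le_iff]
              rintro _ _ _ ⟨i⟩
              exact hf i }
        have (j j' : κ.ord.ToType) (φ : j ⟶ j') : Mono (hf''.F.map φ) := hf''.mem_map φ
        apply IsGrothendieckAbelian.preservesColimit_coyoneda_obj_of_mono (Y := hf''.F) (κ := κ)
        obtain ⟨i⟩ := hi
        exact hκ i }⟩

/-- Every morphism `A i ⟶ W` extends along `f i`. -/
def IsInjectiveAlong {ι : Type*} {A B : ι → ModuleCat.{u} S} (f : ∀ i, A i ⟶ B i)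
    (W : ModuleCat.{u} S) : Prop :=
  ∀ i (φ : A i ⟶ W), ∃ ψ : B i ⟶ W, f i ≫ ψ = φ

theorem shortExact_of_mono {X Y : ModuleCat.{u} S} (f : X ⟶ Y) [Mono f] :
    (ShortComplex.mk f (cokernel.π f) (cokernel.condition f)).ShortExact :=
  ShortComplex.ShortExact.mk' (ShortComplex.exact_cokernel f) inferInstance inferInstance

/-- A special preenvelope for the cotorsion pair generated by the cokernels of the monomorphisms
`f i` with projective target. -/
theorem exists_mono_isInjectiveAlong {ι : Type u} {A B : ι → ModuleCat.{u} S}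
    (f : ∀ i, A i ⟶ B i) [hf : ∀ i, Mono (f i)] [∀ i, Projective (B i)] (M : ModuleCat.{u} S) :
    ∃ (W : ModuleCat.{u} S) (j : M ⟶ W), Mono j ∧ IsInjectiveAlong f W ∧
      ∀ V : ModuleCat.{u} S, IsInjectiveAlong f V → Subsingleton (Ext (cokernel j) V 1) := by
  have := hasSmallObjectArgument_ofHoms f hf
  let I := MorphismProperty.ofHoms f
  let φ := MorphismProperty.factorizationData I.rlp.llp I.rlp (0 : M ⟶ 0)
  have hj (E Q : ModuleCat.{u} S) (p : E ⟶ Q) (hp : I.rlp p) : HasLiftingProperty φ.i p :=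
    φ.hi p hp
  -- Lifting against E → 0, with E an injective module containing M, extends M → E along `φ.i`.
  have hmono : Mono φ.i := by
    have := hj (Injective.under M) 0 0 (by
      rintro _ _ _ ⟨i⟩
      refine ⟨fun {u v} sq => ⟨⟨⟨Injective.factorThru u (f i), by simp, ?_⟩⟩⟩⟩
      exact (isZero_zero _).eq_of_tgt _ _)
    have sq : CommSq (Injective.ι M) φ.i (0 : Injective.under M ⟶ 0) 0 := ⟨by simp⟩
    have h : φ.i ≫ sq.lift = Injective.ι M := sq.fac_left
    exact mono_of_mono_fac h
  refine ⟨φ.Z, φ.i, hmono, fun i g => ?_, fun V hV => ?_⟩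
  · have := φ.hp (f i) ⟨i⟩
    have sq : CommSq g (f i) φ.p 0 := ⟨(isZero_zero _).eq_of_tgt _ _⟩
    exact ⟨sq.lift, sq.fac_left⟩
  · refine subsingleton_ext_of_lifting (shortExact_of_mono (Injective.ι V)) _
      (Ext.subsingleton_of_injective _ _ _) fun g => ?_
    -- The projection from the injective hull term to its quotient has the right lifting property:
    -- lift the bottom map by projectivity of `B i`, then correct by extending the difference, which
    -- lands in V.
    have := hj _ _ (cokernel.π (Injective.ι V)) (by
      rintro _ _ _ ⟨i⟩
      refine ⟨fun {u v} sq => ?_⟩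
      let v' := Projective.factorThru v (cokernel.π (Injective.ι V))
      have hv : v' ≫ cokernel.π (Injective.ι V) = v := Projective.factorThru_comp _ _
      have hS := shortExact_of_mono (Injective.ι V)
      have h0 : (u - f i ≫ v') ≫ cokernel.π (Injective.ι V) = 0 := by
        rw [Preadditive.sub_comp, Category.assoc, hv, sq.w, sub_self]
      obtain ⟨ψ, hψ⟩ := hV i (hS.exact.lift _ h0)
      refine ⟨⟨⟨v' + ψ ≫ Injective.ι V, ?_, ?_⟩⟩⟩
      · have := hS.exact.lift_f _ h0
        rw [Preadditive.comp_add, ← Category.assoc, hψ]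
        exact (congrArg (f i ≫ v' + ·) this).trans (by simp)
      · simp [hv])
    have sq : CommSq 0 φ.i (cokernel.π (Injective.ι V)) (cokernel.π φ.i ≫ g) :=
      ⟨by rw [← Category.assoc, cokernel.condition, zero_comp, zero_comp]⟩
    refine ⟨cokernel.desc φ.i sq.lift sq.fac_left, ?_⟩
    rw [← cancel_epi (cokernel.π φ.i), ← Category.assoc, cokernel.π_desc]
    exact sq.fac_right

end SmallObject

/-! ### Building the complex of projectives from the orthogonal class -/

section Approximation

variable {R : Type u} [Ring R] {n : ℕ}

variable (R n) in
/-- The submodules `N` of finitely generated free right modules `F` such that every homomorphism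
from `N` to a module of FP-injective dimension at most `n` extends to `F`. -/
def ExtendingSubmodule : Type u :=
  {x : Σ m : ℕ, Submodule Rᵐᵒᵖ (Fin m → R) // ∀ W : RightMod R, FPInjDimLE n W →
    ∀ φ : x.2 →ₗ[Rᵐᵒᵖ] W, ∃ ψ : (Fin x.1 → R) →ₗ[Rᵐᵒᵖ] W, ψ ∘ₗ x.2.subtype = φ}

/-- The inclusion of an extending submodule. -/
def ExtendingSubmodule.incl (x : ExtendingSubmodule R n) :
    ModuleCat.of Rᵐᵒᵖ x.1.2 ⟶ ModuleCat.of Rᵐᵒᵖ (Fin x.1.1 → R) :=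
  ModuleCat.ofHom x.1.2.subtype

/-- Ext^{n+1}(F, W) = 0 says that maps to W extend from the (n+1)-st syzygy of F to the free module
containing it. Such syzygies are extending submodules, so a small set of inclusions tests
`FPInjDimLE n`. -/
theorem isInjectiveAlong_incl_iff (hR : IsRightCoherent R) (W : RightMod R) :
    IsInjectiveAlong (ExtendingSubmodule.incl (R := R) (n := n)) W ↔ FPInjDimLE n W := by
  constructor
  · intro h F hF
    obtain ⟨a, B, v, hB, h0, hv⟩ := exists_resolution hR F
    have key (V : RightMod R) := subsingleton_ext_iff V n (fun k => Fin (a k) → R)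
      (fun k => colMap (B k)) hB F _ hv h0
    refine (key W).2 fun φ hφ => ?_
    obtain ⟨g, rfl⟩ := exists_comp_eq_of_ker_le (colMap (B n)).rangeRestrict
      (colMap (B n)).surjective_rangeRestrict φ (by
        rw [LinearMap.ker_rangeRestrict, LinearMap.exact_iff.1 (hB n)]
        rintro _ ⟨x, rfl⟩
        exact LinearMap.congr_fun hφ x)
    obtain ⟨ψ, hψ⟩ := h ⟨⟨_, LinearMap.range (colMap (B n))⟩, fun V hV φ' => by
      obtain ⟨ψ, hψ⟩ := (key V).1 (hV _ hF) (φ' ∘ₗ (colMap (B n)).rangeRestrict) (by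
        refine LinearMap.ext fun x => ?_
        have : (colMap (B n)).rangeRestrict (colMap (B (n + 1)) x) = 0 :=
          Subtype.ext ((hB n _).2 ⟨x, rfl⟩)
        rw [LinearMap.comp_apply, LinearMap.comp_apply, this, map_zero, LinearMap.zero_apply])
      refine ⟨ψ, LinearMap.ext ?_⟩
      rintro ⟨_, x, rfl⟩
      exact LinearMap.congr_fun hψ x⟩ (ModuleCat.ofHom g)
    refine ⟨ψ.hom, LinearMap.ext fun x => ?_⟩
    exact LinearMap.congr_fun (ModuleCat.hom_ext_iff.1 hψ) ((colMap (B n)).rangeRestrict x)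
  · intro h x φ
    obtain ⟨ψ, hψ⟩ := x.2 W h φ.hom
    exact ⟨ModuleCat.ofHom ψ, ModuleCat.hom_ext hψ⟩

variable (R n) in
/-- The left orthogonal class of the modules of FP-injective dimension at most `n`. -/
abbrev perp : Set (RightMod R) := leftPerp {W | FPInjDimLE n W}

/-- `Y` is a cokernel of an embedding of `X` into a projective module. -/
def IsProjectiveStep (X Y : RightMod R) : Prop :=
  ∃ (P : RightMod R) (i : X ⟶ P) (p : P ⟶ Y) (w : i ≫ p = 0),
    Module.Projective Rᵐᵒᵖ P ∧ (ShortComplex.mk i p w).ShortExact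

theorem IsNFCRing.fpInjDimLE_finsupp (hR : IsNFCRing R n) (X : Type u) :
    FPInjDimLE n (ModuleCat.of Rᵐᵒᵖ (X →₀ R)) :=
  hR.fpInjDimLE (k := 0) (isFlat_of_torVanishes hR.leftCoherent (torVanishes_finsupp X 0))

/-- The kernel of a free cover of W has dimension at most n + 1, hence at most n, since any finite
bound improves to n. Orthogonality then splits the cover. -/
theorem IsNFCRing.projective_of_mem_perp (hR : IsNFCRing R n) {W : RightMod R}
    (hW : FPInjDimLE n W) (hW' : W ∈ perp R n) : Module.Projective Rᵐᵒᵖ W := by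
  have hS := shortExact_submodule _ (freeCover (R := R) W) rfl (freeCover_surjective _)
  have hK : FPInjDimLE (n + 1) (ModuleCat.of Rᵐᵒᵖ (LinearMap.ker (freeCover (R := R) W))) :=
    fun G hG => subsingleton_ext_X₁_of_covariant hS G (n + 1) (hW G hG)
      ((hR.fpInjDimLE_finsupp W).succ hR.rightCoherent G hG)
  obtain ⟨r, hr⟩ := exists_extension_of_ext hS _
    (hW' _ (hR.fpInjDimLE (hR.hasFlatResolution hK))) (𝟙 _)
  let s := ShortComplex.Splitting.ofExactOfRetraction _ hS.exact r hr hS.epi_g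
  refine Module.Projective.of_split s.s.hom (freeCover (R := R) W) ?_
  exact ModuleCat.hom_ext_iff.1 s.s_g

/-- The preenvelope W is an extension of two modules of the orthogonal class, so it lies in that
class and is projective. -/
theorem IsNFCRing.exists_isProjectiveStep_right (hR : IsNFCRing R n) {X : RightMod R}
    (hX : X ∈ perp R n) : ∃ Y ∈ perp R n, IsProjectiveStep X Y := by
  have (x : ExtendingSubmodule R n) : Mono x.incl :=
    (ModuleCat.mono_iff_injective _).2 Subtype.val_injective
  have (x : ExtendingSubmodule R n) : Projective (ModuleCat.of Rᵐᵒᵖ (Fin x.1.1 → R)) :=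
    (IsProjective.iff_projective _).1 inferInstance
  obtain ⟨W, j, hj, hW, hC⟩ :=
    exists_mono_isInjectiveAlong (ExtendingSubmodule.incl (R := R) (n := n)) X
  rw [isInjectiveAlong_incl_iff hR.rightCoherent] at hW
  simp only [isInjectiveAlong_incl_iff hR.rightCoherent] at hC
  have hS := shortExact_of_mono j
  exact ⟨cokernel j, hC, W, j, cokernel.π j, cokernel.condition j,
    hR.projective_of_mem_perp hW fun V hV =>
      subsingleton_ext_X₂_of_contravariant hS V 1 (hX V hV) (hC V hV), hS⟩

/-- Ext¹ of the syzygy into W is controlled by Ext²(Y, W), and thus by Ext¹ of Y into a cosyzygy of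
W, which still has dimension at most n. -/
theorem IsNFCRing.exists_isProjectiveStep_left (hR : IsNFCRing R n) {Y : RightMod R}
    (hY : Y ∈ perp R n) : ∃ X ∈ perp R n, IsProjectiveStep X Y := by
  have hS := shortExact_submodule _ (freeCover (R := R) Y) rfl (freeCover_surjective _)
  have hproj : Module.Projective Rᵐᵒᵖ (Y →₀ R) := inferInstance
  have : Projective (ModuleCat.of Rᵐᵒᵖ (Y →₀ R)) := (IsProjective.iff_projective _).1 hproj
  refine ⟨_, fun W hW => ?_, _, _, _, _, hproj, hS⟩
  have hQ := shortExact_of_mono (Injective.ι W)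
  have hQ' : FPInjDimLE n (cokernel (Injective.ι W)) := fun G hG =>
    subsingleton_ext_X₃_of_covariant hQ G (n + 1) (Ext.subsingleton_of_injective _ _ _)
      (FPInjDimLE.succ hR.rightCoherent hW G hG)
  exact subsingleton_ext_X₁_of_contravariant hS W 1 (Ext.subsingleton_of_projective _ _ _)
    (subsingleton_ext_X₁_of_covariant hQ Y 1 (hY _ hQ') (Ext.subsingleton_of_injective _ _ _))

theorem exists_int_sequence {α : Type*} (r : α → α → Prop) (hr : ∀ x, ∃ y, r x y)
    (hl : ∀ y, ∃ x, r x y) (x₀ : α) : ∃ Z : ℤ → α, Z 0 = x₀ ∧ ∀ i, r (Z i) (Z (i + 1)) := by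
  choose f hf using hr
  choose g hg using hl
  refine ⟨fun i => match i with
    | Int.ofNat k => f^[k] x₀
    | Int.negSucc k => g^[k + 1] x₀, rfl, fun i => ?_⟩
  match i with
  | Int.ofNat k =>
    change r (f^[k] x₀) (f^[k + 1] x₀)
    rw [Function.iterate_succ_apply']
    exact hf _
  | Int.negSucc 0 => exact hg x₀
  | Int.negSucc (k + 1) =>
    change r (g^[k + 1 + 1] x₀) (g^[k + 1] x₀)
    rw [Function.iterate_succ_apply']
    exact hg _

theorem IsNFCRing.isDingProjective (hR : IsNFCRing R n) {M : RightMod R} (hM : M ∈ perp R n) :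
    IsDingProjective M := by
  obtain ⟨Z, hZ0, hZ⟩ := exists_int_sequence
    (fun X Y : perp R n => IsProjectiveStep X.1 Y.1)
    (fun X => by
      obtain ⟨Y, hY, h⟩ := hR.exists_isProjectiveStep_right X.2
      exact ⟨⟨Y, hY⟩, h⟩)
    (fun Y => by
      obtain ⟨X, hX, h⟩ := hR.exists_isProjectiveStep_left Y.2
      exact ⟨⟨X, hX⟩, h⟩) ⟨M, hM⟩
  obtain rfl : (Z 0).1 = M := congrArg Subtype.val hZ0
  choose P ι π w hP hS using hZ
  have hmono (i : ℤ) : Mono (ι i) := (hS i).mono_f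
  have hepi (i : ℤ) : Epi (π i) := (hS i).epi_g
  let K : CochainComplex (RightMod R) ℤ := CochainComplex.of P (fun i => π i ≫ ι (i + 1))
    (fun i => by rw [Category.assoc, ← Category.assoc (ι (i + 1)), w, zero_comp, comp_zero])
  have hd (i : ℤ) : K.d i (i + 1) = π i ≫ ι (i + 1) :=
    CochainComplex.of_d P (fun i => π i ≫ ι (i + 1)) i
  refine ⟨K, hP, ?_, ?_, ?_⟩
  · intro j
    obtain ⟨i, rfl⟩ : ∃ i, j = i + 1 := ⟨j - 1, by ring⟩
    rw [K.exactAt_iff' i (i + 1) (i + 1 + 1) (by simp) (by simp),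
      ShortComplex.ShortExact.moduleCat_exact_iff_function_exact]
    change Function.Exact (K.d i (i + 1)) (K.d (i + 1) (i + 1 + 1))
    rw [hd, hd]
    have hex := (ShortComplex.ShortExact.moduleCat_exact_iff_function_exact _).1 (hS (i + 1)).exact
    have hsurj := (ModuleCat.epi_iff_surjective _).1 (hepi i)
    have hinj := (ModuleCat.mono_iff_injective _).1 (hmono (i + 1 + 1))
    intro x
    constructor
    · intro hx
      obtain ⟨y, rfl⟩ := (hex x).1 (hinj (hx.trans (map_zero _).symm))
      obtain ⟨z, rfl⟩ := hsurj y
      exact ⟨z, rfl⟩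
    · rintro ⟨z, rfl⟩
      exact (congrArg (ι (i + 1 + 1)) ((hex _).2 ⟨π i z, rfl⟩)).trans (map_zero _)
  · rintro F hF i _ _ rfl rfl g
    have hF' : FPInjDimLE n F := hR.fpInjDimLE (k := 0) hF
    constructor
    · intro hg
      have h1 : ι (i + 1) ≫ g = 0 := by
        rw [← cancel_epi (π i), comp_zero, ← Category.assoc]
        exact (congrArg (· ≫ g) (hd i).symm).trans hg
      -- `g` factors through the cycle module in degree i + 2, and the obstruction to extending it
      -- lies in Ext¹ of the next one.
      obtain ⟨h, hh⟩ := exists_extension_of_ext (hS (i + 1 + 1)) F ((Z _).2 F hF')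
        ((hS (i + 1)).exact.desc g h1)
      refine ⟨h, ?_⟩
      have h2 : π (i + 1) ≫ (hS (i + 1)).exact.desc g h1 = g := (hS (i + 1)).exact.g_desc g h1
      refine (congrArg (· ≫ h) (hd (i + 1))).trans ?_
      refine (Category.assoc _ _ _).trans ?_
      exact (congrArg (π (i + 1) ≫ ·) hh).trans h2
    · rintro ⟨h, rfl⟩
      change K.d i (i + 1) ≫ K.d (i + 1) (i + 1 + 1) ≫ h = 0
      rw [← Category.assoc, K.d_comp_d, zero_comp]
  · have e : kernel (K.d 0 1) ≅ kernel (π 0) := kernelIsoOfEq (hd 0) ≪≫ kernelCompMono (π 0) (ι 1)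
    exact ⟨IsLimit.conePointUniqueUpToIso (hS 0).fIsKernel (kernelIsKernel (π 0)) ≪≫ e.symm⟩

end Approximation

/-! ### Ding projective modules are orthogonal to trivial modules -/

section DingProjective

variable {R : Type u} [Ring R]

theorem subsingleton_ext_of_iso {X Y : RightMod R} (e : X ≅ Y) (W : RightMod R) (n : ℕ)
    (h : Subsingleton (Ext Y W n)) : Subsingleton (Ext X W n) := by
  refine subsingleton_of_forall_eq 0 fun x => ?_
  have : x = (Ext.mk₀ e.hom).comp ((Ext.mk₀ e.inv).comp x (zero_add n)) (zero_add n) := by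
    rw [Ext.mk₀_comp_mk₀_assoc, e.hom_inv_id, Ext.mk₀_id_comp]
  rw [this, Subsingleton.elim ((Ext.mk₀ e.inv).comp x (zero_add n)) 0, Ext.comp_zero]

theorem IsDingProjective.subsingleton_ext {M : RightMod R} (hM : IsDingProjective M) {k : ℕ}
    {W : RightMod R} (hW : HasFlatResolution k W) : Subsingleton (Ext M W 1) := by
  obtain ⟨P, hP, hac, hhom, ⟨e⟩⟩ := hM
  have hproj (i : ℤ) : Projective (P.X i) := (IsProjective.iff_projective _).1 (hP i)
  let Z (i : ℤ) : Submodule Rᵐᵒᵖ (P.X i) := LinearMap.ker (P.d i (i + 1)).hom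
  let q (i : ℤ) : P.X i →ₗ[Rᵐᵒᵖ] Z (i + 1) := (P.d i (i + 1)).hom.codRestrict _ fun x =>
    LinearMap.congr_fun (ModuleCat.hom_ext_iff.1 (P.d_comp_d i (i + 1) (i + 1 + 1))) x
  have hex (i : ℤ) : Function.Exact (P.d i (i + 1)) (P.d (i + 1) (i + 1 + 1)) := by
    have := hac (i + 1)
    rwa [P.exactAt_iff' i (i + 1) (i + 1 + 1) (by simp) (by simp),
      ShortComplex.ShortExact.moduleCat_exact_iff_function_exact] at this
  have hq (i : ℤ) : Function.Surjective (q i) := by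
    rintro ⟨x, hx⟩
    obtain ⟨y, rfl⟩ := (hex i x).1 hx
    exact ⟨y, rfl⟩
  have hS (i : ℤ) := shortExact_submodule (Z i) (q i) (LinearMap.ker_codRestrict _ _ _) (hq i)
  have hflat (F : RightMod R) (hF : IsFlat F) (i : ℤ) :
      Subsingleton (Ext (ModuleCat.of Rᵐᵒᵖ (Z i)) F 1) := by
    -- A map from the cycles in degree i - 1 to F pulls back to degree i - 2 and kills the
    -- boundaries from degree i - 3.
    obtain ⟨i, rfl⟩ : ∃ l, i = l + 1 + 1 + 1 := ⟨i - 3, by ring⟩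
    refine subsingleton_ext_of_extension (hS (i + 1 + 1)) F
      (Ext.subsingleton_of_projective _ _ _) fun φ => ?_
    obtain ⟨ψ, hψ⟩ := (hhom F hF i (i + 1) (i + 1 + 1) rfl rfl
      (ModuleCat.ofHom (q (i + 1)) ≫ φ)).1 (by
        ext x
        have : q (i + 1) (P.d i (i + 1) x) = 0 := Subtype.ext ((hex i _).2 ⟨x, rfl⟩)
        exact (congrArg φ this).trans (map_zero _))
    refine ⟨ψ, ?_⟩
    ext x
    obtain ⟨y, rfl⟩ := hq (i + 1) x
    exact LinearMap.congr_fun (ModuleCat.hom_ext_iff.1 hψ) y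
  have key (i : ℤ) : Subsingleton (Ext (ModuleCat.of Rᵐᵒᵖ (Z i)) W 1) := by
    induction k generalizing W i with
    | zero => exact hflat W hW i
    | succ k ih =>
      obtain ⟨K, F, f, g, hf, hfg, hg, hF, hK⟩ := hW
      obtain ⟨i, rfl⟩ : ∃ l, i = l + 1 := ⟨i - 1, by ring⟩
      -- Ext¹(Z_{i+1}, W) lies between Ext¹(Z_{i+1}, F) = 0 and Ext²(Z_{i+1}, K), which vanishes
      -- since Ext¹(Z_i, K) does. The change of degree is why the induction covers all cycles at
      -- once.
      exact subsingleton_ext_X₃_of_covariant (shortExact_of_hom f g hf hfg hg) _ 1 (hflat F hF _)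
        (subsingleton_ext_X₃_of_contravariant (hS i) K 1 (ih hK i)
          (Ext.subsingleton_of_projective _ _ _))
  exact subsingleton_ext_of_iso (e ≪≫ ModuleCat.kernelIsoKer _) W 1 (key 0)

end DingProjective

end DingChen

theorem mainTheorem5 (R : Type u) [Ring R] (hR : DingChen.IsDingChenRing R) :
    (∀ M : DingChen.RightMod R, DingChen.IsDingProjective M ↔
      M ∈ DingChen.leftPerp {W : DingChen.RightMod R | DingChen.IsTrivial W}) ∧
    {M : DingChen.RightMod R | DingChen.IsDingProjective M} =
      DingChen.leftPerp {W : DingChen.RightMod R | DingChen.flatDim W < ⊤} ∧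
    {M : DingChen.RightMod R | DingChen.IsDingProjective M} =
      DingChen.leftPerp {W : DingChen.RightMod R | DingChen.fpInjDim W < ⊤} := by
  obtain ⟨n, hR⟩ := hR
  have h1 (W : DingChen.RightMod R) : DingChen.fpInjDim W < ⊤ ↔ DingChen.FPInjDimLE n W := by
    rw [DingChen.fpInjDim_lt_top_iff]
    exact ⟨fun ⟨_, h⟩ => hR.fpInjDimLE (hR.hasFlatResolution h), fun h => ⟨n, h⟩⟩
  have h2 (W : DingChen.RightMod R) : DingChen.flatDim W < ⊤ ↔ DingChen.FPInjDimLE n W := by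
    rw [DingChen.flatDim_lt_top_iff]
    exact ⟨fun ⟨_, h⟩ => hR.fpInjDimLE h, fun h => ⟨n, hR.hasFlatResolution h⟩⟩
  have h (M : DingChen.RightMod R) : DingChen.IsDingProjective M ↔ M ∈ DingChen.perp R n :=
    ⟨fun hM _ hW => hM.subsingleton_ext (hR.hasFlatResolution hW), hR.isDingProjective⟩
  simp only [DingChen.IsTrivial, h1, h2, or_self]
  exact ⟨h, Set.ext h, Set.ext h⟩
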